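/- Let $X$ be a compact (Hausdorff) connected abelian group of finite topological dimension $d=\dim X$, with normalized Haar measure $m$. A finite set $F$ of epimorphisms (continuous surjective self-homomorphisms) of $X$ is called mixing if for all sets $B_\gamma\subset X$, $\gamma\in F$, that are measurable with respect to the completion of the Borel $\sigma$-algebra, $$m\Big(\bigcap_{\gamma\in F}\gamma^{-n}(B_\gamma)\Big)\to\prod_{\gamma\in F}m(B_\gamma)\qquad\text{as } n\to\infty .$$ Let $\hat X$ be the character group of $X$. A continuous endomorphism $T$ of $X$ induces the endomorphism $\chi\mapsto\chi\circ T$ of $\hat X$, which extends to a linear map $\hat T$ of the rational vector space $\mathbb{Q}\otimes_{\mathbb{Z}}\hat X$; denote by $\mathrm{Spec}(T)\subset\mathbb{C}$ the set of complex eigenvalues of $\hat T$. Let $T_1,\ldots,T_s$ be distinct epimorphisms of $X$. (a) If $\mathrm{Spec}(T_i^l)\cap\mathrm{Spec}(T_j^l)=\emptyset$ for every $l\ge 1$ and all $i\ne j$ in $\{1,\ldots,s\}$, then $\{T_1,\ldots,T_s\}$ is mixing. (b) If $\bigcap_{i\in S}\mathrm{Spec}(T_i^l)\ne\emptyset$ for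 some $l\ge 1$ and some $S\subset\{1,\ldots,s\}$ with $|S|>d$, then $\{T_1,\ldots,T_s\}$ is not mixing. (c) If $s\ge d$ and $\bigcap_{i\in S}\mathrm{Spec}(T_i^l)=\emptyset$ for every $l\ge 1$ and every $S\subset\{1,\ldots,s\}$ with $|S|>d$, then $\{T_1,\ldots,T_s\}$ is mixing if and only if each of its subsets of cardinality $d$ is mixing. -/

import Mathlib

open MeasureTheory Set Filter Topology
open scoped TensorProduct ENNReal

/-- Every finite open cover of `X` has a finite open refinement, again covering `X`, such that
every point of `X` lies in at most `n + 1` of its members. -/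
def CoveringDimLE (X : Type*) [TopologicalSpace X] (n : ℕ) : Prop :=
  ∀ 𝒰 : Set (Set X), 𝒰.Finite → (∀ U ∈ 𝒰, IsOpen U) → ⋃₀ 𝒰 = univ →
    ∃ 𝒱 : Set (Set X), 𝒱.Finite ∧ (∀ V ∈ 𝒱, IsOpen V) ∧ ⋃₀ 𝒱 = univ ∧
      (∀ V ∈ 𝒱, ∃ U ∈ 𝒰, V ⊆ U) ∧ ∀ x : X, {V ∈ 𝒱 | x ∈ V}.encard ≤ n + 1

/-- The topological (Lebesgue covering) dimension of a nonempty space `X`: the least `n` with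
`CoveringDimLE X n`, and `⊤` if there is none. -/
noncomputable def coveringDim (X : Type*) [TopologicalSpace X] : ℕ∞ :=
  ⨅ (n : ℕ) (_ : CoveringDimLE X n), (n : ℕ∞)

section Endomorphisms

variable {X : Type*} [CommGroup X] [TopologicalSpace X]

/-- The `n`-th iterate `T ∘ ⋯ ∘ T` of a continuous endomorphism. (The expression `T ^ n` would
denote the pointwise power `x ↦ (T x) ^ n` instead.) -/
def iterHom (T : X →ₜ* X) : ℕ → (X →ₜ* X)
  | 0 => ContinuousMonoidHom.id X
  | n + 1 => (iterHom T n).comp T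

theorem coe_iterHom (T : X →ₜ* X) (n : ℕ) : ⇑(iterHom T n) = (⇑T)^[n] := by
  induction n with
  | zero => rfl
  | succ n ih =>
    rw [Function.iterate_succ, ← ih]
    rfl

/-- The endomorphism `χ ↦ χ ∘ T` of the character group of `X`, written additively. -/
noncomputable def dualEnd (T : X →ₜ* X) :
    Additive (PontryaginDual X) →ₗ[ℤ] Additive (PontryaginDual X) :=
  (MonoidHom.toAdditive (PontryaginDual.map T).toMonoidHom).toIntLinearMap

/-- The extension of the dual endomorphism of `T` to a linear map of the rational vector space
spanned by the character group of `X`. -/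
noncomputable def dualRat (T : X →ₜ* X) :
    (ℚ ⊗[ℤ] Additive (PontryaginDual X)) →ₗ[ℚ] (ℚ ⊗[ℤ] Additive (PontryaginDual X)) :=
  (dualEnd T).baseChange ℚ

/-- The set of complex eigenvalues of the rational linear map dual to `T`. -/
noncomputable def dualSpec (T : X →ₜ* X) : Set ℂ :=
  {z : ℂ | Module.End.HasEigenvalue ((dualRat T).baseChange ℂ) z}

variable [IsTopologicalGroup X] [CompactSpace X] [MeasurableSpace X] [BorelSpace X]

/-- The Haar measure of a compact group, normalized to have total mass one. -/
noncomputable def normalizedHaar (X : Type*) [CommGroup X] [TopologicalSpace X]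
    [IsTopologicalGroup X] [CompactSpace X] [MeasurableSpace X] [BorelSpace X] : Measure X :=
  Measure.haarMeasure (⊤ : TopologicalSpace.PositiveCompacts X)

/-- A finite set `F` of endomorphisms is mixing if `m (⋂ γ⁻ⁿ (B γ)) → ∏ m (B γ)` for all sets
`B γ`, `γ ∈ F`, that are measurable for the completion of the Borel `σ`-algebra. -/
def IsMixingSet (F : Finset (X →ₜ* X)) : Prop :=
  ∀ B : (X →ₜ* X) → Set X, (∀ γ ∈ F, NullMeasurableSet (B γ) (normalizedHaar X)) →
    Tendsto (fun n : ℕ => normalizedHaar X (⋂ γ ∈ F, (⇑γ)^[n] ⁻¹' B γ)) atTop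
      (𝓝 (∏ γ ∈ F, normalizedHaar X (B γ)))

end Endomorphisms

/-! Everything reduces to one algebraic criterion, `not_isMixingSet_iff`. Let V be the rational span
of the character group and A_i the linear map on V dual to T_i. By density of trigonometric
polynomials and orthogonality of characters, mixing fails exactly when there are characters χ_i, not
all trivial, such that ∏ χ_i ∘ T_i^n is trivial for infinitely many n. Characters of a connected
group are torsion free, so they embed in V and this says that ∑ A_i^n v_i = 0 for infinitely many n,
for some nonzero family v.

Since the T_i are onto, the A_i are injective, and the Skolem–Mahler–Lech argument (a p-adic
analytic function with infinitely many integer zeros vanishes) upgrades infinitely many zeros to an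
arithmetic progression a + lm. Over ℂ, the families all of whose iterates under the A_i^l sum to
zero form a nonzero invariant subspace, which contains an eigenvector: vectors w_i, not all zero,
with A_i^l w_i = z w_i and ∑ w_i = 0. Conversely, rational coordinates of such w_i give back
rational vectors, hence characters, after clearing denominators.

The three claims are then linear algebra, given dim V ≤ d. (a) A vanishing sum has at least two
nonzero w_i, so two spectra share z. (b) More than d eigenvectors for z in a space of dimension at
most d are dependent, and a dependence is such a relation. (c) The nonzero w_i share the eigenvalue
z, so there are at most d of them, and the relation lives on a subset of size d.

The bound dim V ≤ d is topological. Independent characters χ_1, …, χ_r yield, by Pontryagin duality,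
a map c from ℝ^r to X with χ_j(c(t)) = exp(iπt_j); Lebesgue's covering theorem for the cube then
forces r ≤ dim X. Separation of points by characters, duality and the covering theorem are proved
along the way. -/

section PadicZeros

/-! ### p-adic functions with infinitely many zeros -/

open Polynomial in
/-- A function on `ℕ` given by a Newton series with `p`-adically small tail is small as soon as it
has many zeros. -/
theorem padicNorm_sum_le_of_zeros (p : ℕ) [hp : Fact p.Prime] (F : ℕ → ℤ[X])
    (hF : ∀ j, (F j).natDegree ≤ j) (a : ℕ → ℚ) (ε : ℚ) (hε : 0 ≤ ε) (x : Finset ℕ) (M : ℕ)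
    (ha : ∀ j, x.card ≤ j → padicNorm p (a j) ≤ ε)
    (hx : ∀ i ∈ x, ∑ j ∈ Finset.range M, a j * ((F j).eval (i : ℤ) : ℤ) = 0) (m : ℕ) :
    padicNorm p (∑ j ∈ Finset.range M, a j * ((F j).eval (m : ℤ) : ℤ)) ≤ ε := by
  classical
  -- Division by the monic polynomial vanishing on the zeros keeps quotients integral. The quotients
  -- of low degree terms are zero, and the combination of the remainders has degree below the number
  -- of its zeros, so only D times the small tail survives.
  set D : ℤ[X] := ∏ i ∈ x, (X - C (i : ℤ)) with hD
  have hDm : D.Monic := monic_prod_of_monic _ _ fun i _ => monic_X_sub_C _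
  have hDdeg : D.natDegree = x.card := by
    rw [hD, natDegree_prod_of_monic _ _ fun i _ => monic_X_sub_C _]
    simp only [natDegree_X_sub_C, Finset.sum_const, smul_eq_mul, mul_one]
  have hDx : ∀ i ∈ x, D.eval (i : ℤ) = 0 := by
    intro i hi
    rw [hD, eval_prod]
    exact Finset.prod_eq_zero hi (by simp)
  set Q : ℕ → ℤ[X] := fun j => F j /ₘ D
  set R : ℕ → ℤ[X] := fun j => F j %ₘ D
  have hFe : ∀ j, ∀ n : ℤ, (((F j).eval n : ℤ) : ℚ) =
      ((R j).eval n : ℤ) + (D.eval n : ℤ) * ((Q j).eval n : ℤ) := by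
    intro j n
    have := congrArg (eval n) (modByMonic_add_div (F j) D)
    rw [eval_add, eval_mul] at this
    rw [← this]
    push_cast
    rfl
  have hQ : ∀ j, j < x.card → Q j = 0 := by
    intro j hj
    refine (divByMonic_eq_zero_iff hDm).2 ?_
    refine degree_lt_degree ?_
    rw [hDdeg]
    exact (hF j).trans_lt hj
  set P : ℚ[X] := ∑ j ∈ Finset.range M, a j • (R j).map (Int.castRingHom ℚ) with hP
  have hPe : ∀ n : ℤ, P.eval (n : ℚ) = ∑ j ∈ Finset.range M, a j * ((R j).eval n : ℤ) := by
    intro n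
    rw [hP, eval_finsetSum]
    refine Finset.sum_congr rfl fun j _ => ?_
    rw [eval_smul, eval_intCast_map]
    simp
  have hP0 : P = 0 := by
    have hdeg : P.degree < x.card := by
      rw [hP]
      refine (degree_sum_le _ _).trans_lt ?_
      refine (Finset.sup_lt_iff (WithBot.bot_lt_coe _)).2 fun j _ => ?_
      refine (degree_smul_le _ _).trans_lt (degree_map_le.trans_lt ?_)
      have := degree_modByMonic_lt (F j) hDm
      rwa [degree_eq_natDegree hDm.ne_zero, hDdeg] at this
    refine eq_zero_of_degree_lt_of_eval_finset_eq_zero (s := x.image (fun i : ℕ => (i : ℚ))) ?_ ?_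
    · rwa [Finset.card_image_of_injective _ Nat.cast_injective]
    · intro y hy
      obtain ⟨i, hi, rfl⟩ := Finset.mem_image.1 hy
      have h1 := hx i hi
      have h2 := hPe i
      simp only [hFe, hDx i hi] at h1
      simp only [Int.cast_natCast] at h2
      rw [h2]
      simpa using h1
  have hfm : ∑ j ∈ Finset.range M, a j * ((F j).eval (m : ℤ) : ℤ)
      = ∑ j ∈ Finset.range M, a j * (D.eval (m : ℤ) * (Q j).eval (m : ℤ) : ℤ) := by
    have h := hPe m
    rw [hP0, eval_zero] at h
    simp only [hFe, mul_add, Finset.sum_add_distrib]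
    rw [← h, zero_add]
    push_cast
    rfl
  rw [hfm]
  refine padicNorm.sum_le' (fun j _ => ?_) hε
  by_cases hj : j < x.card
  · simp [hQ j hj, hε]
  · rw [padicNorm.mul]
    exact (mul_le_of_le_one_right (padicNorm.nonneg _) (padicNorm.of_int _)).trans
      (ha j (not_lt.1 hj))

/-- By Legendre's formula (p - 1) v_p(j!) ≤ j, so for p ≥ 3 the factorial cancels at most half of
the powers of p. For p = 2 there would be no uniform gain. -/
theorem padicNorm_pow_div_factorial_le (p : ℕ) [hp : Fact p.Prime] (hp2 : p ≠ 2) (j : ℕ) :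
    padicNorm p ((p : ℚ) ^ j / (j.factorial : ℚ)) ≤ ((p : ℚ)⁻¹) ^ (j / 2) := by
  have hp3 : 3 ≤ p := by
    have := hp.out.two_le
    omega
  have hv : 2 * padicValNat p j.factorial ≤ j := by
    have h := sub_one_mul_padicValNat_factorial (p := p) j
    have : 2 * padicValNat p j.factorial ≤ (p - 1) * padicValNat p j.factorial :=
      Nat.mul_le_mul_right _ (by omega)
    omega
  have hp0 : (p : ℚ) ≠ 0 := by exact_mod_cast hp.out.ne_zero
  have hj : (j.factorial : ℚ) ≠ 0 := by exact_mod_cast j.factorial_ne_zero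
  rw [padicNorm.eq_zpow_of_nonzero (div_ne_zero (pow_ne_zero _ hp0) hj),
    padicValRat.div (pow_ne_zero _ hp0) hj, padicValRat.pow, padicValRat.self hp.out.one_lt,
    padicValRat.of_nat, inv_pow, ← zpow_natCast, ← zpow_neg]
  refine zpow_le_zpow_right₀ (by exact_mod_cast hp.out.one_lt.le) ?_
  omega

/-- A binomial series `∑ C(m,j) p^j c_j` with bounded coefficients and infinitely many zeros
vanishes identically. -/
theorem eq_zero_of_infinite_zeros (p : ℕ) [hp : Fact p.Prime] (hp2 : p ≠ 2) (c : ℕ → ℚ) (K : ℚ)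
    (hK : ∀ j, padicNorm p (c j) ≤ K) (f : ℕ → ℚ)
    (hf : ∀ m, f m = ∑ j ∈ Finset.range (m + 1), (m.choose j : ℚ) * ((p : ℚ) ^ j * c j))
    (hinf : {m | f m = 0}.Infinite) (m : ℕ) : f m = 0 := by
  have hK0 : 0 ≤ K := (padicNorm.nonneg _).trans (hK 0)
  set a : ℕ → ℚ := fun j => (p : ℚ) ^ j / (j.factorial : ℚ) * c j
  have hfM : ∀ M m, m < M → f m =
      ∑ j ∈ Finset.range M, a j * ((descPochhammer ℤ j).eval (m : ℤ) : ℤ) := by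
    intro M m hm
    rw [hf, Finset.sum_subset (Finset.range_mono hm)]
    · refine Finset.sum_congr rfl fun j _ => ?_
      rw [descPochhammer_eval_eq_descFactorial, Nat.descFactorial_eq_factorial_mul_choose]
      have hj : (j.factorial : ℚ) ≠ 0 := by exact_mod_cast j.factorial_ne_zero
      simp only [a]
      push_cast
      field_simp
    · intro j _ hj
      rw [Nat.choose_eq_zero_of_lt (by simpa using hj)]
      simp
  -- Any k of the zeros may be used, and the Newton coefficients from index k on are bounded by
  -- p^(-⌊k/2⌋) K; then k → ∞.
  have hbound : ∀ k : ℕ, padicNorm p (f m) ≤ ((p : ℚ)⁻¹) ^ (k / 2) * K := by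
    intro k
    obtain ⟨x, hxs, hxk⟩ := hinf.exists_subset_card_eq k
    obtain ⟨M, hM⟩ : ∃ M, ∀ i ∈ insert m x, i < M :=
      ⟨(insert m x).sup id + 1, fun i hi => Nat.lt_succ_of_le (Finset.le_sup (f := id) hi)⟩
    rw [hfM M m (hM m (Finset.mem_insert_self _ _))]
    have hpi : (p : ℚ)⁻¹ ≤ 1 := inv_le_one_of_one_le₀ (by exact_mod_cast hp.out.one_lt.le)
    refine padicNorm_sum_le_of_zeros p (fun j => descPochhammer ℤ j)
      (fun j => (descPochhammer_natDegree ℤ j).le) a _ (by positivity) x M ?_ ?_ m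
    · intro j hj
      rw [padicNorm.mul]
      refine mul_le_mul ((padicNorm_pow_div_factorial_le p hp2 j).trans ?_) (hK j)
        (padicNorm.nonneg _) (by positivity)
      exact pow_le_pow_of_le_one (by positivity) hpi (Nat.div_le_div_right (hxk ▸ hj))
    · intro i hi
      rw [← hfM M i (hM i (Finset.mem_insert_of_mem hi))]
      exact hxs hi
  have hlim : Tendsto (fun k : ℕ => ((p : ℚ)⁻¹) ^ (2 * k / 2) * K) atTop (𝓝 0) := by
    simp only [Nat.mul_div_cancel_left _ two_pos]
    rw [← zero_mul K]
    refine (tendsto_pow_atTop_nhds_zero_of_lt_one (by positivity) ?_).mul_const K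
    exact inv_lt_one_of_one_lt₀ (by exact_mod_cast hp.out.one_lt)
  have h0 : padicNorm p (f m) ≤ 0 := ge_of_tendsto' hlim fun k => hbound (2 * k)
  exact padicNorm.zero_of_padicNorm_eq_zero (le_antisymm h0 (padicNorm.nonneg _))

end PadicZeros

/-! ### The Skolem–Mahler–Lech argument -/

section Recurrences

/-- An integer matrix of nonzero determinant has a power congruent to the identity modulo some odd
prime. -/
theorem exists_pow_eq_one_add_prime_smul {ι : Type*} [Fintype ι] [DecidableEq ι]
    (A : Matrix ι ι ℤ) (hA : A.det ≠ 0) :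
    ∃ p : ℕ, p.Prime ∧ p ≠ 2 ∧ ∃ N : ℕ, 1 ≤ N ∧ ∃ B : Matrix ι ι ℤ, A ^ N = 1 + (p : ℤ) • B := by
  -- A prime above |det A| does not divide it, so A is invertible modulo p and has finite order
  -- there; the 3 excludes p = 2.
  obtain ⟨p, hpge, hp⟩ := Nat.exists_infinite_primes (A.det.natAbs + 3)
  have : Fact p.Prime := ⟨hp⟩
  refine ⟨p, hp, by omega, ?_⟩
  set φ := (Int.castRingHom (ZMod p)).mapMatrix (m := ι)
  have hdet : IsUnit (φ A).det := by
    rw [isUnit_iff_ne_zero, ← RingHom.map_det]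
    intro h
    have hd : (p : ℤ) ∣ A.det := (ZMod.intCast_zmod_eq_zero_iff_dvd _ _).1 (by simpa using h)
    have := Nat.le_of_dvd (Int.natAbs_pos.2 hA) (Int.natCast_dvd.1 hd)
    omega
  obtain ⟨u, hu⟩ := (Matrix.isUnit_iff_isUnit_det _).2 hdet
  refine ⟨orderOf u, orderOf_pos u, ?_⟩
  have h1 : φ (A ^ orderOf u - 1) = 0 := by
    rw [map_sub, map_pow, ← hu, map_one, ← Units.val_pow_eq_pow_val, pow_orderOf_eq_one]
    simp
  have h2 : ∀ i j, (p : ℤ) ∣ (A ^ orderOf u - 1) i j := by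
    intro i j
    refine (ZMod.intCast_zmod_eq_zero_iff_dvd _ _).1 ?_
    simpa [φ] using congrFun (congrFun h1 i) j
  choose B hB using h2
  refine ⟨Matrix.of B, ?_⟩
  rw [← sub_eq_iff_eq_add']
  ext i j
  rw [hB i j]
  simp

/-- With A^N = 1 + pB, the binomial theorem makes φ(A^(Nm)) a series ∑ C(m,j) p^j φ(B^j), whose
coefficients are p-adically bounded because B^j is integral. The same N serves every φ. -/
theorem Matrix.exists_pow_infinite_zeros {ι : Type*} [Fintype ι] [DecidableEq ι]
    (A : Matrix ι ι ℤ) (hA : A.det ≠ 0) :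
    ∃ N : ℕ, 1 ≤ N ∧ ∀ φ : Matrix ι ι ℤ →+ ℚ, {m : ℕ | φ (A ^ (N * m)) = 0}.Infinite →
      ∀ m, φ (A ^ (N * m)) = 0 := by
  obtain ⟨p, hp, hp2, N, hN, B, hB⟩ := exists_pow_eq_one_add_prime_smul A hA
  have : Fact p.Prime := ⟨hp⟩
  refine ⟨N, hN, fun φ hinf m => ?_⟩
  refine eq_zero_of_infinite_zeros p hp2 (fun j => φ (B ^ j))
    (∑ i, ∑ j, padicNorm p (φ (Matrix.single i j 1))) ?_ (fun m => φ (A ^ (N * m))) ?_ hinf m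
  · intro k
    have hK0 : 0 ≤ ∑ i, ∑ j, padicNorm p (φ (Matrix.single i j 1)) :=
      Finset.sum_nonneg fun i _ => Finset.sum_nonneg fun j _ => padicNorm.nonneg _
    rw [Matrix.matrix_eq_sum_single (B ^ k), map_sum]
    refine padicNorm.sum_le' (fun i _ => ?_) hK0
    rw [map_sum]
    refine padicNorm.sum_le' (fun j _ => ?_) hK0
    have : Matrix.single i j ((B ^ k) i j) = ((B ^ k) i j) • Matrix.single i j (1 : ℤ) := by
      simp
    rw [this, map_zsmul, zsmul_eq_mul, padicNorm.mul]
    refine (mul_le_of_le_one_left (padicNorm.nonneg _) (padicNorm.of_int _)).trans ?_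
    refine (Finset.single_le_sum (f := fun j => padicNorm p (φ (Matrix.single i j 1)))
      (fun j _ => padicNorm.nonneg _) (Finset.mem_univ j)).trans ?_
    exact Finset.single_le_sum (f := fun i => ∑ j, padicNorm p (φ (Matrix.single i j 1)))
      (fun i _ => Finset.sum_nonneg fun j _ => padicNorm.nonneg _) (Finset.mem_univ i)
  · intro m
    rw [pow_mul, hB, add_comm, Commute.add_pow (Commute.one_right _), map_sum]
    refine Finset.sum_congr rfl fun j _ => ?_
    have : ((p : ℤ) • B) ^ j * 1 ^ (m - j) * ((m.choose j : ℕ) : Matrix ι ι ℤ)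
        = ((m.choose j : ℤ) * (p : ℤ) ^ j) • B ^ j := by
      rw [one_pow, mul_one, smul_pow, ← nsmul_eq_mul', mul_smul]
      simp
    rw [this, map_zsmul, zsmul_eq_mul]
    push_cast
    ring

/-- If a linear image of the orbit of `w` under an injective endomorphism vanishes infinitely often,
then it vanishes along an arithmetic progression. -/
theorem exists_arithProgression_of_infinite_zeros {W U : Type*} [AddCommGroup W] [Module ℚ W]
    [FiniteDimensional ℚ W] [AddCommGroup U] [Module ℚ U] (A : Module.End ℚ W)
    (hA : Function.Injective A) (L : W →ₗ[ℚ] U) (w : W) (hinf : {n : ℕ | L ((A ^ n) w) = 0}.Infinite) :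
    ∃ a N : ℕ, 1 ≤ N ∧ ∀ m : ℕ, L ((A ^ (a + N * m)) w) = 0 := by
  classical
  let b := Module.finBasis ℚ W
  let AQ := LinearMap.toMatrix b b A
  -- Scaling A by a common denominator D multiplies the n-th term by D^n ≠ 0, which does not affect
  -- the zeros.
  obtain ⟨D, hD⟩ := IsLocalization.exist_integer_multiples_of_finite (nonZeroDivisors ℤ)
    (S := ℚ) (fun ij : Fin (Module.finrank ℚ W) × Fin (Module.finrank ℚ W) => AQ ij.1 ij.2)
  choose A' hA' using hD
  have hD0 : ((D : ℤ) : ℚ) ≠ 0 := by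
    exact_mod_cast nonZeroDivisors.ne_zero D.2
  let φ := (Int.castRingHom ℚ).mapMatrix (m := Fin (Module.finrank ℚ W))
  set M : Matrix _ _ ℤ := Matrix.of fun i j => A' (i, j)
  have hM : φ M = ((D : ℤ) : ℚ) • AQ := by
    ext i j
    have := hA' (i, j)
    simpa [φ, M, zsmul_eq_mul] using this
  have hMdet : M.det ≠ 0 := by
    intro h
    have h1 : (φ M).det = 0 := by rw [← RingHom.map_det, h, map_zero]
    rw [hM, Matrix.det_smul, mul_eq_zero] at h1
    have h2 : AQ.det ≠ 0 := by
      rw [LinearMap.det_toMatrix]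
      exact ((LinearEquiv.ofInjectiveEndo A hA).isUnit_det').ne_zero
    exact h1.elim (pow_ne_zero _ hD0) h2
  obtain ⟨N, hN, hz⟩ := M.exists_pow_infinite_zeros hMdet
  have key : ∀ n, Matrix.toLin b b (φ (M ^ n)) = ((D : ℤ) : ℚ) ^ n • A ^ n := by
    intro n
    rw [map_pow, hM, smul_pow, map_smul, Matrix.toLin_pow, Matrix.toLin_toMatrix]
  -- Pigeonhole: some residue class modulo N contains infinitely many zeros.
  obtain ⟨a, ha⟩ : ∃ a : ℕ, {m : ℕ | L ((A ^ (a + N * m)) w) = 0}.Infinite := by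
    by_contra! hcon
    refine hinf ?_
    refine (Set.Finite.biUnion (Set.finite_lt_nat N)
      (fun a _ => (hcon a).image (fun m => a + N * m))).subset ?_
    intro n hn
    refine Set.mem_biUnion (x := n % N) (Nat.mod_lt _ hN) ⟨n / N, ?_, Nat.mod_add_div n N⟩
    simpa [Nat.mod_add_div] using hn
  refine ⟨a, N, hN, fun m => ?_⟩
  rw [← Module.forall_dual_apply_eq_zero_iff ℚ]
  intro f
  let ψ : Matrix (Fin (Module.finrank ℚ W)) (Fin (Module.finrank ℚ W)) ℤ →+ ℚ :=
    { toFun := fun P => f (L (Matrix.toLin b b (φ (M ^ a * P)) w))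
      map_zero' := by simp
      map_add' := by
        intro P Q
        simp [mul_add] }
  have hψ : ∀ m, ψ (M ^ (N * m)) =
      ((D : ℤ) : ℚ) ^ (a + N * m) * f (L ((A ^ (a + N * m)) w)) := by
    intro m
    change f (L (Matrix.toLin b b (φ (M ^ a * M ^ (N * m))) w)) = _
    rw [← pow_add, key]
    simp
  have h0 := hz ψ (ha.mono fun m hm => by
    have hm' : L ((A ^ (a + N * m)) w) = 0 := hm
    rw [Set.mem_ofPred_eq, hψ, hm', map_zero, mul_zero]) m
  rw [hψ] at h0
  exact (mul_eq_zero.1 h0).resolve_left (pow_ne_zero _ hD0)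

end Recurrences

/-! ### Characters separate points: Gelfand theory applied to the regular representation -/

section SeparatingCharacters

open scoped IsMulCommutative in
open WeakDual StarSubalgebra in
/-- A unitary representation of a commutative group which commutes with a self-adjoint operator `S`
and is norm continuous after multiplication by `S` yields continuous characters of the group. -/
theorem exists_character_of_unitary_rep {B : Type*} [CStarAlgebra B] {G : Type*} [CommGroup G]
    [TopologicalSpace G] (U : G →* B) (hU : ∀ x, star (U x) = U x⁻¹) (S : B)
    (hS : IsSelfAdjoint S) (hc : ∀ x, U x * S = S * U x) (hcont : Continuous fun x => U x * S)
    {a : G} (ha : U a * S ≠ S) : ∃ χ : G →ₜ* Circle, χ a ≠ 1 := by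
  have hUU : ∀ x y, U x * U y = U y * U x := fun x y => by rw [← map_mul, mul_comm, map_mul]
  set g : Set B := insert S (range U) with hg
  let C : StarSubalgebra ℂ B := (StarAlgebra.adjoin ℂ g).topologicalClosure
  have hC : IsClosed (C : Set B) := (StarAlgebra.adjoin ℂ g).isClosed_topologicalClosure
  have : IsMulCommutative (StarAlgebra.adjoin ℂ g) := by
    refine StarAlgebra.isMulCommutative_adjoin ℂ ?_ ?_
    · rintro x (rfl | ⟨x, rfl⟩) y (rfl | ⟨y, rfl⟩)
      · rfl
      · exact (hc y).symm
      · exact hc x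
      · exact hUU x y
    · rintro x (rfl | ⟨x, rfl⟩) y (rfl | ⟨y, rfl⟩)
      · rw [hS.star_eq]
      · rw [hU]
        exact (hc _).symm
      · rw [hS.star_eq]
        exact hc x
      · rw [hU]
        exact hUU x _
  let _ : CommRing C := (StarAlgebra.adjoin ℂ g).commRingTopologicalClosure mul_comm
  let _ : CommCStarAlgebra C := { }
  have hmem : ∀ b ∈ g, b ∈ C := fun b hb =>
    le_topologicalClosure _ (StarAlgebra.subset_adjoin ℂ g hb)
  let S' : C := ⟨S, hmem S (mem_insert _ _)⟩
  let U' : G → C := fun x => ⟨U x, hmem _ (mem_insert_of_mem _ (mem_range_self x))⟩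
  have hU'mul : ∀ x y, U' (x * y) = U' x * U' y := fun x y => Subtype.ext (map_mul U x y)
  have hU'one : U' 1 = 1 := Subtype.ext (map_one U)
  have hU'star : ∀ x, star (U' x) = U' x⁻¹ := fun x => Subtype.ext (hU x)
  have hne : U' a * S' - S' ≠ 0 := fun h => ha (congrArg Subtype.val (sub_eq_zero.1 h))
  -- The C*-algebra generated by S and the U x is commutative, so its characters detect nonzero
  -- elements. Such a ψ has ψ(S) ≠ 0, and x ↦ ψ(U x) = ψ(U x S)/ψ(S) is the continuous character
  -- sought.
  obtain ⟨ψ, hψ⟩ : ∃ ψ : characterSpace ℂ C, ψ (U' a * S' - S') ≠ 0 := by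
    by_contra! h
    refine hne ((gelfandTransform_isometry C).injective ?_)
    ext ψ
    simpa using h ψ
  have hψS : ψ S' ≠ 0 := by
    intro h
    rw [map_sub, map_mul, h] at hψ
    simp at hψ
  have hψU : ∀ x, ‖ψ (U' x)‖ = 1 := by
    intro x
    have h1 : star (ψ (U' x)) * ψ (U' x) = 1 := by
      rw [← map_star, hU'star, ← map_mul, ← hU'mul, inv_mul_cancel, hU'one, map_one]
    have h2 : ‖ψ (U' x)‖ * ‖ψ (U' x)‖ = 1 := by
      rw [← CStarRing.norm_star_mul_self, h1, norm_one]
    nlinarith [norm_nonneg (ψ (U' x))]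
  have hcts : Continuous fun x => ψ (U' x) := by
    have h1 : Continuous fun x => U' x * S' := by
      rw [continuous_induced_rng]
      exact hcont
    have h2 : Continuous fun x => ψ (U' x * S') / ψ S' :=
      ((map_continuous ψ).comp h1).div_const _
    convert h2 using 2 with x
    rw [map_mul, mul_div_cancel_right₀ _ hψS]
  refine ⟨{ toFun := fun x => ⟨ψ (U' x), mem_sphere_zero_iff_norm.2 (hψU x)⟩
            map_one' := Subtype.ext ?_
            map_mul' := fun x y => Subtype.ext ?_
            continuous_toFun := hcts.subtype_mk _ }, ?_⟩
  · simp [hU'one]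
  · exact (congrArg ψ (hU'mul x y)).trans (map_mul ψ _ _)
  · intro h
    have h1 : ψ (U' a) = 1 := congrArg Subtype.val h
    rw [map_sub, map_mul, h1, one_mul, sub_self] at hψ
    exact hψ rfl

variable {X : Type*} [CommGroup X] [TopologicalSpace X] [IsTopologicalGroup X]

/-- The translate `y ↦ f (x * y)` of a continuous function. -/
noncomputable def translateC (x : X) (f : C(X, ℂ)) : C(X, ℂ) :=
  f.comp ⟨fun y => x * y, by fun_prop⟩

theorem continuous_translateC (f : C(X, ℂ)) : Continuous fun x : X => translateC x f :=
  (ContinuousMap.curry ⟨fun p : X × X => f (p.1 * p.2), by fun_prop⟩).continuous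

theorem translateC_translateC (x y : X) (f : C(X, ℂ)) :
    translateC x (translateC y f) = translateC (x * y) f := by
  ext z
  simp only [translateC, ContinuousMap.comp_apply, ContinuousMap.coe_mk]
  rw [← mul_assoc, mul_comm y x]

variable [CompactSpace X] [MeasurableSpace X] [BorelSpace X]

instance : Measure.IsHaarMeasure (normalizedHaar X) := by
  unfold normalizedHaar
  infer_instance

instance : (normalizedHaar X).Regular := by
  unfold normalizedHaar
  infer_instance

instance : IsProbabilityMeasure (normalizedHaar X) :=
  ⟨by
    have := Measure.haarMeasure_self (K₀ := (⊤ : TopologicalSpace.PositiveCompacts X))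
    simpa [normalizedHaar] using this⟩


/-- Translation of functions in `L²`. -/
noncomputable def translateL2 (x : X) :
    Lp ℂ 2 (normalizedHaar X) →L[ℂ] Lp ℂ 2 (normalizedHaar X) :=
  (Lp.compMeasurePreservingₗᵢ ℂ (fun y => x * y)
    (measurePreserving_mul_left (normalizedHaar X) x)).toContinuousLinearMap

theorem translateL2_toLp (x : X) (f : C(X, ℂ)) :
    translateL2 x (ContinuousMap.toLp 2 (normalizedHaar X) ℂ f) =
      ContinuousMap.toLp 2 (normalizedHaar X) ℂ (translateC x f) := by
  refine Lp.ext ?_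
  refine (Lp.coeFn_compMeasurePreserving _ (measurePreserving_mul_left (normalizedHaar X) x)).trans ?_
  refine EventuallyEq.trans ?_ (ContinuousMap.coeFn_toLp (normalizedHaar X) _).symm
  exact (measurePreserving_mul_left (normalizedHaar X) x).quasiMeasurePreserving.ae_eq_comp
    (ContinuousMap.coeFn_toLp (normalizedHaar X) f)

theorem translateL2_mul (x y : X) : translateL2 (x * y) = translateL2 x * translateL2 y := by
  ext1 g
  have h := Lp.compMeasurePreserving_comp_apply g
    (measurePreserving_mul_left (normalizedHaar X) y)
    (measurePreserving_mul_left (normalizedHaar X) x)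
  refine Eq.trans ?_ h
  change Lp.compMeasurePreserving _ _ g = _
  congr 1
  congr 1
  ext z
  simp [mul_assoc, mul_left_comm]

theorem translateL2_one : translateL2 (1 : X) = 1 := by
  ext1 g
  refine Eq.trans ?_ (Lp.compMeasurePreserving_id_apply g)
  change Lp.compMeasurePreserving _ _ g = _
  congr 1
  congr 1
  ext z
  simp

/-- The regular representation. -/
noncomputable def regularRep : X →* (Lp ℂ 2 (normalizedHaar X) →L[ℂ] Lp ℂ 2 (normalizedHaar X)) where
  toFun := translateL2
  map_one' := translateL2_one
  map_mul' := translateL2_mul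

theorem inner_translateL2 (x : X) (f g : Lp ℂ 2 (normalizedHaar X)) :
    inner ℂ (translateL2 x f) g = inner ℂ f (translateL2 x⁻¹ g) := by
  have h : g = translateL2 x (translateL2 x⁻¹ g) := by
    have := DFunLike.congr_fun (translateL2_mul x x⁻¹) g
    rw [mul_inv_cancel, translateL2_one] at this
    exact this
  conv_lhs => rw [h]
  let Φ : Lp ℂ 2 (normalizedHaar X) →ₗᵢ[ℂ] Lp ℂ 2 (normalizedHaar X) :=
    Lp.compMeasurePreservingₗᵢ ℂ (fun y => x * y)
      (measurePreserving_mul_left (normalizedHaar X) x)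
  exact Φ.inner_map_map _ _

theorem star_translateL2 (x : X) : star (translateL2 x) = translateL2 x⁻¹ := by
  rw [ContinuousLinearMap.star_eq_adjoint]
  refine ((ContinuousLinearMap.eq_adjoint_iff _ _).2 fun f g => ?_).symm
  rw [inner_translateL2, inv_inv]

theorem norm_toLp_translateC_le (x : X) (f : C(X, ℂ)) :
    ‖ContinuousMap.toLp 2 (normalizedHaar X) ℂ (translateC x f)‖ ≤ ‖f‖ := by
  let Φ : C(X, ℂ) →L[ℂ] Lp ℂ 2 (normalizedHaar X) := ContinuousMap.toLp 2 (normalizedHaar X) ℂ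
  refine (Φ.le_opNorm _).trans ?_
  have h1 : ‖(ContinuousMap.toLp 2 (normalizedHaar X) ℂ : C(X, ℂ) →L[ℂ] _)‖ ≤ 1 := by
    refine (ContinuousMap.toLp_norm_le (normalizedHaar X)).trans ?_
    simp [measureUnivNNReal]
  have h2 : ‖translateC x f‖ ≤ ‖f‖ :=
    (ContinuousMap.norm_le _ (norm_nonneg _)).2 fun y => f.norm_coe_le_norm _
  exact (mul_le_of_le_one_left (norm_nonneg _) h1).trans h2

/-- The map `g ↦ (x ↦ ⟪f (x⁻¹ ·), g⟫)`, with values in continuous functions. -/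
noncomputable def convolutionC (f : C(X, ℂ)) : Lp ℂ 2 (normalizedHaar X) →ₗ[ℂ] C(X, ℂ) where
  toFun g := ⟨fun x => inner ℂ (ContinuousMap.toLp 2 (normalizedHaar X) ℂ (translateC x⁻¹ f)) g, by
    have := continuous_translateC f
    fun_prop⟩
  map_add' g h := by
    ext x
    exact inner_add_right (𝕜 := ℂ) (ContinuousMap.toLp 2 (normalizedHaar X) ℂ (translateC x⁻¹ f)) g h
  map_smul' c g := by
    ext x
    exact inner_smul_right (𝕜 := ℂ) (ContinuousMap.toLp 2 (normalizedHaar X) ℂ (translateC x⁻¹ f)) g c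

theorem convolutionC_apply (f : C(X, ℂ)) (g : Lp ℂ 2 (normalizedHaar X)) (x : X) :
    convolutionC f g x =
      inner ℂ (ContinuousMap.toLp 2 (normalizedHaar X) ℂ (translateC x⁻¹ f)) g := rfl

theorem norm_convolutionC_le (f : C(X, ℂ)) (g : Lp ℂ 2 (normalizedHaar X)) :
    ‖convolutionC f g‖ ≤ ‖f‖ * ‖g‖ := by
  refine (ContinuousMap.norm_le _ (by positivity)).2 fun x => ?_
  refine (norm_inner_le_norm (𝕜 := ℂ)
    (ContinuousMap.toLp 2 (normalizedHaar X) ℂ (translateC x⁻¹ f)) g).trans ?_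
  gcongr
  exact norm_toLp_translateC_le _ _

/-- The convolution operator `g ↦ (x ↦ ⟪f (x⁻¹ ·), g⟫)` on `L²`. -/
noncomputable def convolutionL2 (f : C(X, ℂ)) :
    Lp ℂ 2 (normalizedHaar X) →L[ℂ] Lp ℂ 2 (normalizedHaar X) :=
  (ContinuousMap.toLp 2 (normalizedHaar X) ℂ).comp <|
    (convolutionC f).mkContinuous ‖f‖ (norm_convolutionC_le f)

theorem convolutionL2_apply (f : C(X, ℂ)) (g : Lp ℂ 2 (normalizedHaar X)) :
    convolutionL2 f g = ContinuousMap.toLp 2 (normalizedHaar X) ℂ (convolutionC f g) := rfl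

theorem norm_convolutionL2_le (f : C(X, ℂ)) : ‖convolutionL2 f‖ ≤ ‖f‖ := by
  refine ContinuousLinearMap.opNorm_le_bound _ (norm_nonneg _) fun g => ?_
  have h := norm_toLp_translateC_le 1 (convolutionC f g)
  have h1 : translateC 1 (convolutionC f g) = convolutionC f g := by
    ext x
    simp [translateC]
  rw [h1] at h
  exact h.trans (norm_convolutionC_le f g)

theorem convolutionL2_sub (f h : C(X, ℂ)) :
    convolutionL2 (f - h) = convolutionL2 f - convolutionL2 h := by
  ext1 g
  rw [sub_apply, convolutionL2_apply, convolutionL2_apply, convolutionL2_apply,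
    ← map_sub]
  congr 1
  ext x
  rw [ContinuousMap.sub_apply, convolutionC_apply, convolutionC_apply, convolutionC_apply,
    ← inner_sub_left, ← map_sub]
  rfl

/-- Combined with norm continuity of translation on continuous functions, this makes x ↦ U_x R norm
continuous for a convolution R, although x ↦ U_x is in general only strongly continuous on L². -/
theorem continuous_convolutionL2 : Continuous (convolutionL2 (X := X)) := by
  refine LipschitzWith.continuous (K := 1) (LipschitzWith.of_dist_le_mul fun f h => ?_)
  rw [dist_eq_norm, dist_eq_norm, ← convolutionL2_sub, NNReal.coe_one, one_mul]
  exact norm_convolutionL2_le _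

theorem translateL2_mul_convolutionL2 (x : X) (f : C(X, ℂ)) :
    translateL2 x * convolutionL2 f = convolutionL2 (translateC x⁻¹ f) := by
  ext1 g
  rw [mul_apply_eq_comp, convolutionL2_apply, convolutionL2_apply, translateL2_toLp]
  congr 1
  ext y
  change convolutionC f g (x * y) = _
  rw [convolutionC_apply, convolutionC_apply, translateC_translateC, mul_inv, mul_comm]

theorem convolutionL2_mul_translateL2 (x : X) (f : C(X, ℂ)) :
    convolutionL2 f * translateL2 x = convolutionL2 (translateC x⁻¹ f) := by
  ext1 g
  rw [mul_apply_eq_comp, convolutionL2_apply, convolutionL2_apply]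
  congr 1
  ext y
  rw [convolutionC_apply, convolutionC_apply, ← inv_inv x, ← inner_translateL2, translateL2_toLp,
    translateC_translateC, translateC_translateC, mul_comm, inv_inv]

/-- Characters separate the points of a compact abelian group. -/
theorem exists_character_ne_one [T2Space X] {a : X} (ha : a ≠ 1) :
    ∃ χ : PontryaginDual X, χ a ≠ 1 := by
  obtain ⟨f, hf0, hf1, -⟩ := exists_continuous_zero_one_of_isClosed (isClosed_singleton (x := a⁻¹))
    (isClosed_singleton (x := (1 : X))) (by simpa using ha)
  -- The self-adjoint operator used is R*R. If translation by a fixed it, it would fix R, hence the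
  -- translate of f₀ by a⁻¹ would equal f₀, contradicting f₀(a⁻¹) = 0 and f₀(1) = 1.
  let f₀ : C(X, ℂ) := ⟨fun x => (f x : ℂ), by fun_prop⟩
  let R := convolutionL2 f₀
  have hRU : ∀ x, R * translateL2 x = translateL2 x * R := fun x => by
    rw [convolutionL2_mul_translateL2, translateL2_mul_convolutionL2]
  have hRU' : ∀ x, star R * translateL2 x = translateL2 x * star R := fun x => by
    have := congrArg star (hRU x⁻¹)
    rw [star_mul, star_mul, star_translateL2, inv_inv] at this
    exact this.symm
  refine exists_character_of_unitary_rep regularRep star_translateL2 (star R * R)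
    (IsSelfAdjoint.star_mul_self R) (fun x => ?_) ?_ (a := a) fun h => ?_
  · change translateL2 x * (star R * R) = star R * R * translateL2 x
    rw [mul_assoc, hRU, ← mul_assoc, ← mul_assoc, hRU']
  · have : (fun x => regularRep x * (star R * R)) =
        fun x => star R * convolutionL2 (translateC x⁻¹ f₀) := by
      funext x
      change translateL2 x * (star R * R) = _
      rw [← mul_assoc, ← hRU', mul_assoc, translateL2_mul_convolutionL2]
    rw [this]
    have h1 := continuous_translateC f₀
    have h2 := continuous_convolutionL2 (X := X)
    fun_prop
  · replace h : translateL2 a * (star R * R) = star R * R := h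
    have hR : translateL2 a * R = R := by
      rw [← mul_assoc, ← hRU', mul_assoc, ← sub_eq_zero, ← mul_sub] at h
      rw [← sub_eq_zero]
      have h3 : translateL2 a * R - R = R * (translateL2 a - 1) := by
        rw [mul_sub, hRU, mul_one]
      rw [h3] at h ⊢
      rw [← CStarRing.star_mul_self_eq_zero_iff, star_mul, mul_assoc, h, mul_zero]
    have h4 : ∀ g, inner ℂ (ContinuousMap.toLp 2 (normalizedHaar X) ℂ (translateC a⁻¹ f₀)) g =
        inner ℂ (ContinuousMap.toLp 2 (normalizedHaar X) ℂ f₀) g := by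
      intro g
      have h5 := DFunLike.congr_fun hR g
      rw [translateL2_mul_convolutionL2, convolutionL2_apply, convolutionL2_apply] at h5
      have h6 := ContinuousMap.congr_fun (ContinuousMap.toLp_injective (normalizedHaar X) h5) 1
      rw [convolutionC_apply, convolutionC_apply, translateC_translateC, inv_one, one_mul] at h6
      have h7 : translateC 1 f₀ = f₀ := by
        ext x
        simp [translateC]
      rwa [h7] at h6
    have h8 := ContinuousMap.congr_fun
      (ContinuousMap.toLp_injective (normalizedHaar X) (ext_inner_right ℂ h4)) 1
    have h9 : f a⁻¹ = 0 := hf0 rfl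
    have h10 : f 1 = 1 := hf1 rfl
    simp [translateC, f₀, h9, h10] at h8

end SeparatingCharacters

/-! ### Density and orthogonality of characters; Pontryagin duality -/

section CharacterDensity

variable {X : Type*} [CommGroup X] [TopologicalSpace X]

/-- Evaluation of characters at a point. -/
noncomputable def charEval (x : X) : PontryaginDual X →* Circle where
  toFun χ := χ x
  map_one' := rfl
  map_mul' _ _ := rfl

theorem prod_map_iterHom_apply {ι : Type*} (F : Finset ι) (T : ι → X →ₜ* X)
    (χ : ι → PontryaginDual X) (n : ℕ) (x : X) :
    (∏ i ∈ F, PontryaginDual.map (iterHom (T i) n) (χ i)) x = ∏ i ∈ F, χ i ((T i)^[n] x) := by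
  refine (map_prod (charEval x) _ _).trans (Finset.prod_congr rfl fun i _ => ?_)
  exact congrArg (χ i) (congrFun (coe_iterHom (T i) n) x)

/-- A character as a complex valued continuous function. -/
noncomputable def charC (χ : PontryaginDual X) : C(X, ℂ) := ⟨fun x => (χ x : ℂ), by fun_prop⟩

theorem charC_apply (χ : PontryaginDual X) (x : X) : charC χ x = (χ x : ℂ) := rfl

theorem charC_mul (χ ψ : PontryaginDual X) : charC (χ * ψ) = charC χ * charC ψ := by
  ext x
  exact Circle.coe_mul (χ x) (ψ x)

theorem charC_one : charC (1 : PontryaginDual X) = 1 := by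
  ext x
  exact Circle.coe_one

theorem star_charC (χ : PontryaginDual X) : star (charC χ) = charC χ⁻¹ := by
  ext x
  exact (Circle.coe_inv_eq_conj (χ x)).symm

/-- Γ is closed under products and inverses, and inversion is complex conjugation, so the linear
span is already a star algebra. -/
theorem adjoin_charC (Γ : Subgroup (PontryaginDual X)) :
    Subalgebra.toSubmodule (StarAlgebra.adjoin ℂ (charC '' (Γ : Set (PontryaginDual X)))).toSubalgebra
      = Submodule.span ℂ (charC '' (Γ : Set (PontryaginDual X))) := by
  have hstar : star (charC '' (Γ : Set (PontryaginDual X))) ⊆ charC '' Γ := by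
    rintro f ⟨χ, hχ, hf⟩
    refine ⟨χ⁻¹, Γ.inv_mem hχ, ?_⟩
    rw [← star_charC, hf, star_star]
  rw [StarAlgebra.adjoin_toSubalgebra, union_eq_self_of_subset_right hstar]
  refine Algebra.adjoin_eq_span_of_subset _ (Subset.trans ?_ Submodule.subset_span)
  intro f hf
  refine Submonoid.closure_induction (fun _ => id) ⟨1, Γ.one_mem, charC_one⟩ ?_ hf
  rintro - - - - ⟨χ, hχ, rfl⟩ ⟨ψ, hψ, rfl⟩
  exact ⟨χ * ψ, Γ.mul_mem hχ hψ, charC_mul χ ψ⟩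

/-- This is Stone–Weierstrass for the star algebra spanned by Γ. -/
theorem dense_span_charC [CompactSpace X] (Γ : Subgroup (PontryaginDual X))
    (hΓ : ∀ a : X, a ≠ 1 → ∃ χ ∈ Γ, χ a ≠ 1) (f : C(X, ℂ)) {ε : ℝ} (hε : 0 < ε) :
    ∃ p ∈ Submodule.span ℂ (charC '' (Γ : Set (PontryaginDual X))), ‖f - p‖ < ε := by
  set A := StarAlgebra.adjoin ℂ (charC '' (Γ : Set (PontryaginDual X))) with hA
  have hsep : A.SeparatesPoints := by
    intro x y hxy
    obtain ⟨χ, hχ, hne⟩ := hΓ (x * y⁻¹) (by rwa [Ne, mul_inv_eq_one])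
    refine ⟨_, ⟨charC χ, StarAlgebra.subset_adjoin ℂ _ ⟨χ, hχ, rfl⟩, rfl⟩, ?_⟩
    intro h
    refine hne ?_
    rw [map_mul, map_inv, mul_inv_eq_one]
    exact Subtype.ext h
  have htop := ContinuousMap.starSubalgebra_topologicalClosure_eq_top_of_separatesPoints _ hsep
  have hf : f ∈ closure (A : Set C(X, ℂ)) := by
    rw [← StarSubalgebra.topologicalClosure_coe, htop]
    trivial
  obtain ⟨p, hp, hd⟩ := Metric.mem_closure_iff.1 hf ε hε
  refine ⟨p, ?_, by rwa [← dist_eq_norm]⟩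
  rw [← adjoin_charC]
  exact hp

variable [IsTopologicalGroup X] [CompactSpace X] [MeasurableSpace X] [BorelSpace X]

theorem ContinuousMap.integrable_normalizedHaar (f : C(X, ℂ)) : Integrable f (normalizedHaar X) :=
  f.continuous.integrable_of_hasCompactSupport (HasCompactSupport.of_compactSpace f)

/-- Translating by a point a with χ(a) ≠ 1 multiplies the integral by χ(a) without changing it. -/
theorem integral_charC_of_ne_one {χ : PontryaginDual X} (hχ : χ ≠ 1) :
    ∫ x, (χ x : ℂ) ∂(normalizedHaar X) = 0 := by
  obtain ⟨a, ha⟩ : ∃ a, χ a ≠ 1 := by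
    by_contra! h
    exact hχ (PontryaginDual.ext h)
  have h1 := integral_mul_left_eq_self (μ := normalizedHaar X) (fun x => (χ x : ℂ)) a
  simp only [map_mul, Circle.coe_mul, integral_const_mul] at h1
  by_contra h2
  exact ha (Circle.coe_eq_one.1 (mul_right_cancel₀ h2 (h1.trans (one_mul _).symm)))

/-- A group of characters separating the points of a compact abelian group contains all
characters. -/
theorem eq_top_of_separates (Γ : Subgroup (PontryaginDual X))
    (hΓ : ∀ a : X, a ≠ 1 → ∃ χ ∈ Γ, χ a ≠ 1) : Γ = ⊤ := by
  refine (Subgroup.eq_top_iff' Γ).2 fun ψ => ?_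
  by_contra hψ
  -- A character outside Γ is orthogonal to the span of Γ, yet is uniformly approximated by it.
  have h0 : ∀ p ∈ Submodule.span ℂ (charC '' (Γ : Set (PontryaginDual X))),
      ∫ x, p x * ((ψ⁻¹ x : Circle) : ℂ) ∂(normalizedHaar X) = 0 := by
    intro p hp
    induction hp using Submodule.span_induction with
    | mem p hp =>
      obtain ⟨χ, hχ, rfl⟩ := hp
      have hne : χ * ψ⁻¹ ≠ 1 := by
        intro h
        rw [mul_inv_eq_one] at h
        exact hψ (h ▸ hχ)
      exact integral_charC_of_ne_one hne
    | zero => simp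
    | add p q _ _ hp hq =>
      have h1 := (p * charC ψ⁻¹).integrable_normalizedHaar
      have h2 := (q * charC ψ⁻¹).integrable_normalizedHaar
      have h3 := integral_add h1 h2
      simp only [ContinuousMap.mul_apply, charC_apply, hp, hq] at h3
      simpa only [ContinuousMap.add_apply, add_mul, add_zero] using h3
    | smul c p _ hp =>
      simp only [ContinuousMap.smul_apply, smul_eq_mul, mul_assoc, integral_const_mul, hp, mul_zero]
  obtain ⟨p, hp, hd⟩ := dense_span_charC Γ hΓ (charC ψ) one_pos
  have h1 := h0 p hp
  have h2 : ∫ x, (charC ψ x - p x) * ((ψ⁻¹ x : Circle) : ℂ) ∂(normalizedHaar X) = 1 := by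
    have h3 := integral_sub (charC ψ * charC ψ⁻¹).integrable_normalizedHaar
      (p * charC ψ⁻¹).integrable_normalizedHaar
    simp only [← charC_mul, mul_inv_cancel, charC_one] at h3
    simp only [ContinuousMap.mul_apply, charC_apply, h1] at h3
    simp only [sub_mul]
    refine Eq.trans ?_ (h3.trans (by simp))
    congr 1
    ext x
    have h4 := ContinuousMap.congr_fun (charC_mul ψ ψ⁻¹) x
    rw [mul_inv_cancel, charC_one] at h4
    rw [h4]
    rfl
  have h3 : ‖∫ x, (charC ψ x - p x) * ((ψ⁻¹ x : Circle) : ℂ) ∂(normalizedHaar X)‖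
      ≤ ‖charC ψ - p‖ := by
    refine (norm_integral_le_of_norm_le_const (C := ‖charC ψ - p‖)
      (Eventually.of_forall fun x => ?_)).trans (by simp)
    rw [norm_mul, Circle.norm_coe, mul_one]
    exact (charC ψ - p).norm_coe_le_norm x
  rw [h2, norm_one] at h3
  linarith

end CharacterDensity

/-- Pontryagin duality: every character of the dual of a compact abelian group is an evaluation. -/
theorem exists_eval_eq {X : Type*} [CommGroup X] [TopologicalSpace X] [CompactSpace X] (θ : PontryaginDual X →* Circle) :
    ∃ x : X, ∀ χ, χ x = θ χ := by
  let Y := PontryaginDual (PontryaginDual X)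
  let ev : X →* Y :=
    { toFun := fun x =>
        { toFun := fun χ => χ x
          map_one' := rfl
          map_mul' := fun _ _ => rfl
          continuous_toFun := continuous_of_discreteTopology }
      map_one' := PontryaginDual.ext fun χ => map_one χ
      map_mul' := fun x y => PontryaginDual.ext fun χ => map_mul χ x y }
  have hev : Continuous ev := by
    refine ContinuousMonoidHom.isInducing_toContinuousMap _ _ |>.continuous_iff.2 ?_
    refine ContinuousMap.continuous_of_continuous_uncurry _ ?_
    exact continuous_prod_of_discrete_right.2 fun χ => map_continuous χ
  let K : Subgroup Y := ev.range
  have hK : IsClosed (K : Set Y) := (isCompact_range hev).isClosed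
  let ψ : Y := { toMonoidHom := θ, continuous_toFun := continuous_of_discreteTopology }
  suffices hψ : ψ ∈ K by
    obtain ⟨x, hx⟩ := hψ
    exact ⟨x, fun χ => DFunLike.congr_fun hx χ⟩
  -- If ψ were outside the closed image K of X, a character of Y/K would be nontrivial at ψ. Its
  -- pullback to Y is evaluation at some χ, because evaluations separate points of Y; triviality on
  -- K means χ = 1, so the pullback is trivial.
  by_contra hψ
  borelize (Y ⧸ K)
  borelize Y
  obtain ⟨η, hη⟩ := exists_character_ne_one (X := Y ⧸ K) (a := (ψ : Y ⧸ K))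
    (by rwa [Ne, QuotientGroup.eq_one_iff])
  let η' : PontryaginDual Y :=
    { toMonoidHom := (η : Y ⧸ K →* Circle).comp (QuotientGroup.mk' K)
      continuous_toFun := (map_continuous η).comp QuotientGroup.continuous_mk }
  let E : PontryaginDual X →* PontryaginDual Y :=
    { toFun := fun χ =>
        { toFun := fun y => y χ
          map_one' := rfl
          map_mul' := fun _ _ => rfl
          continuous_toFun := by
            exact continuous_eval_const (F := PontryaginDual X →ₜ* Circle) χ }
      map_one' := PontryaginDual.ext fun y => map_one y
      map_mul' := fun χ χ' => PontryaginDual.ext fun y => map_mul y χ χ' }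
  have htop := eq_top_of_separates E.range fun y hy => by
    by_contra! h
    refine hy (PontryaginDual.ext fun χ => ?_)
    exact h (E χ) ⟨χ, rfl⟩
  obtain ⟨χ, hχ⟩ : η' ∈ E.range := htop ▸ Subgroup.mem_top _
  have h1 : ∀ x : X, χ x = 1 := by
    intro x
    have h2 : E χ (ev x) = η' (ev x) := by rw [hχ]
    refine h2.trans ?_
    have h3 : ((ev x : Y) : Y ⧸ K) = 1 := (QuotientGroup.eq_one_iff _).2 ⟨x, rfl⟩
    exact (congrArg η h3).trans (map_one η)
  have h2 : χ = 1 := PontryaginDual.ext h1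
  refine hη ?_
  have h3 : η' ψ = 1 := by
    rw [← hχ, h2, map_one]
    rfl
  exact h3

/-! ### Mixing in terms of characters -/

section Mixing

variable {X : Type*} [CommGroup X] [TopologicalSpace X] [IsTopologicalGroup X]
  [CompactSpace X] [MeasurableSpace X] [BorelSpace X]

/-- A correlation limit which holds for all characters holds for all integrable functions. -/
theorem tendsto_integral_mul_of_characters [T2Space X] (S : ℕ → X → X)
    (hS : ∀ n, MeasurePreserving (S n) (normalizedHaar X) (normalizedHaar X)) (R : ℕ → X → ℂ)
    (hR : ∀ n, AEStronglyMeasurable (R n) (normalizedHaar X)) (C : ℝ) (hC : ∀ n x, ‖R n x‖ ≤ C)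
    (c : ℂ) (h : ∀ χ : PontryaginDual X,
      Tendsto (fun n => ∫ x, (χ (S n x) : ℂ) * R n x ∂(normalizedHaar X)) atTop
        (𝓝 ((∫ x, (χ x : ℂ) ∂(normalizedHaar X)) * c)))
    (g : X → ℂ) (hg : Integrable g (normalizedHaar X)) :
    Tendsto (fun n => ∫ x, g (S n x) * R n x ∂(normalizedHaar X)) atTop
        (𝓝 ((∫ x, g x ∂(normalizedHaar X)) * c)) := by
  set m := normalizedHaar X
  have hC0 : 0 ≤ C := (norm_nonneg _).trans (hC 0 1)
  have hint : ∀ (f : X → ℂ), Integrable f m → ∀ n, Integrable (fun x => f (S n x) * R n x) m :=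
    fun f hf n => ((hS n).integrable_comp_of_integrable hf).mul_bdd (c := C) (hR n)
      (Eventually.of_forall (hC n))
  have hpoly : ∀ p ∈ Submodule.span ℂ (charC '' ((⊤ : Subgroup (PontryaginDual X)) : Set _)),
      Tendsto (fun n => ∫ x, p (S n x) * R n x ∂m) atTop (𝓝 ((∫ x, p x ∂m) * c)) := by
    intro p hp
    induction hp using Submodule.span_induction with
    | mem p hp =>
      obtain ⟨χ, -, rfl⟩ := hp
      exact h χ
    | zero => simp
    | add p q _ _ hp hq =>
      have := hp.add hq
      rw [← add_mul, ← integral_add p.integrable_normalizedHaar q.integrable_normalizedHaar] at this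
      refine this.congr fun n => ?_
      rw [← integral_add (hint p p.integrable_normalizedHaar n)
        (hint q q.integrable_normalizedHaar n)]
      simp only [ContinuousMap.add_apply, add_mul]
    | smul a p _ hp =>
      have := hp.const_mul a
      simp only [ContinuousMap.smul_apply, smul_eq_mul, mul_assoc, integral_const_mul]
      exact this
  have happrox : ∀ ε > 0, ∃ p ∈ Submodule.span ℂ
      (charC '' ((⊤ : Subgroup (PontryaginDual X)) : Set _)), ∫ x, ‖g x - p x‖ ∂m ≤ ε := by
    intro ε hε
    obtain ⟨f, hf, hfi⟩ := hg.exists_boundedContinuous_integral_sub_le (half_pos hε)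
    obtain ⟨p, hp, hpf⟩ := dense_span_charC ⊤ (fun a ha => by
      obtain ⟨χ, hχ⟩ := exists_character_ne_one ha
      exact ⟨χ, trivial, hχ⟩) f.toContinuousMap (half_pos hε)
    refine ⟨p, hp, ?_⟩
    have hpi := p.integrable_normalizedHaar
    have h1 : ∫ x, ‖f x - p x‖ ∂m ≤ ε / 2 := by
      refine (integral_mono (hfi.sub hpi).norm (integrable_const (ε / 2)) fun x => ?_).trans
        (by simp)
      exact ((f.toContinuousMap - p).norm_coe_le_norm x).trans hpf.le
    calc ∫ x, ‖g x - p x‖ ∂m ≤ ∫ x, (‖g x - f x‖ + ‖f x - p x‖) ∂m := by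
          refine integral_mono (hg.sub hpi).norm ((hg.sub hfi).norm.add (hfi.sub hpi).norm)
            fun x => ?_
          exact norm_sub_le_norm_sub_add_norm_sub _ _ _
      _ = ∫ x, ‖g x - f x‖ ∂m + ∫ x, ‖f x - p x‖ ∂m :=
          integral_add (hg.sub hfi).norm (hfi.sub hpi).norm
      _ ≤ ε := by linarith
  rw [Metric.tendsto_atTop]
  intro ε hε
  -- Replacing g by p costs at most δC in the correlations and δ‖c‖ in the limit; the 1 keeps the
  -- denominator positive and the final inequality manageable.
  obtain ⟨p, hp, hgp⟩ := happrox (ε / (2 * (C + ‖c‖ + 1))) (by positivity)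
  have hpi := p.integrable_normalizedHaar
  obtain ⟨N, hN⟩ := Metric.tendsto_atTop.1 (hpoly p hp) (ε / 2) (half_pos hε)
  refine ⟨N, fun n hn => ?_⟩
  set δ := ∫ x, ‖g x - p x‖ ∂m
  have hδ : δ * (C + ‖c‖ + 1) ≤ ε / 2 := by
    calc δ * (C + ‖c‖ + 1) ≤ ε / (2 * (C + ‖c‖ + 1)) * (C + ‖c‖ + 1) := by gcongr
      _ = ε / 2 := by field_simp
  have hδ0 : 0 ≤ δ := integral_nonneg fun x => norm_nonneg _
  have e1 : ‖∫ x, g (S n x) * R n x ∂m - ∫ x, p (S n x) * R n x ∂m‖ ≤ δ * C := by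
    rw [← integral_sub (hint g hg n) (hint p hpi n)]
    refine (norm_integral_le_integral_norm _).trans ?_
    have h2 : ∫ x, ‖g (S n x) - p (S n x)‖ ∂m = δ :=
      (integral_map (hS n).aemeasurable (by
        rw [(hS n).map_eq]
        exact (hg.sub hpi).norm.aestronglyMeasurable)).symm.trans (by rw [(hS n).map_eq])
    rw [← h2, ← integral_mul_const]
    refine integral_mono ((hint g hg n).sub (hint p hpi n)).norm
      (((hS n).integrable_comp_of_integrable (hg.sub hpi).norm).mul_const C) fun x => ?_
    simp only
    rw [← sub_mul, norm_mul]
    exact mul_le_mul_of_nonneg_left (hC n x) (norm_nonneg _)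
  have e2 : ‖(∫ x, p x ∂m) * c - (∫ x, g x ∂m) * c‖ ≤ δ * ‖c‖ := by
    rw [← sub_mul, norm_mul, ← integral_sub hpi hg]
    refine mul_le_mul_of_nonneg_right ((norm_integral_le_integral_norm _).trans ?_) (norm_nonneg _)
    refine le_of_eq (integral_congr_ae (Eventually.of_forall fun x => norm_sub_rev _ _))
  have e3 := hN n hn
  rw [dist_eq_norm] at e3 ⊢
  have : ∫ x, g (S n x) * R n x ∂m - (∫ x, g x ∂m) * c =
      (∫ x, g (S n x) * R n x ∂m - ∫ x, p (S n x) * R n x ∂m) +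
      (∫ x, p (S n x) * R n x ∂m - (∫ x, p x ∂m) * c) +
      ((∫ x, p x ∂m) * c - (∫ x, g x ∂m) * c) := by ring
  rw [this]
  refine (norm_add₃_le).trans_lt ?_
  nlinarith

theorem measurePreserving_iterate {T : X →ₜ* X} (hT : Function.Surjective T) (n : ℕ) :
    MeasurePreserving (⇑T)^[n] (normalizedHaar X) (normalizedHaar X) :=
  (MonoidHom.measurePreserving (f := (T : X →* X)) (map_continuous T) hT rfl).iterate n

/-- For characters, both sides are decided by orthogonality. Characters are then exchanged for
bounded functions one index at a time, the other factors acting as a bounded multiplier. -/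
theorem tendsto_integral_prod_of_characters [T2Space X] {ι : Type*} [DecidableEq ι]
    (F : Finset ι) (T : ι → X →ₜ* X) (hT : ∀ i ∈ F, Function.Surjective (T i))
    (h : ∀ χ : ι → PontryaginDual X, (∃ i ∈ F, χ i ≠ 1) →
      ∀ᶠ n in atTop, ∃ x, ∏ i ∈ F, χ i ((T i)^[n] x) ≠ 1)
    (f : ι → X → ℂ) (hfm : ∀ i, AEStronglyMeasurable (f i) (normalizedHaar X))
    (hfb : ∀ i x, ‖f i x‖ ≤ 1) :
    Tendsto (fun n : ℕ => ∫ x, ∏ i ∈ F, f i ((T i)^[n] x) ∂(normalizedHaar X)) atTop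
      (𝓝 (∏ i ∈ F, ∫ x, f i x ∂(normalizedHaar X))) := by
  set m := normalizedHaar X
  -- J is the set of indices whose functions are no longer required to be characters.
  suffices H : ∀ J : Finset ι, J ⊆ F → ∀ f : ι → X → ℂ, (∀ i, AEStronglyMeasurable (f i) m) →
      (∀ i x, ‖f i x‖ ≤ 1) →
      (∀ i ∉ J, ∃ χ : PontryaginDual X, f i = fun x => (χ x : ℂ)) →
      Tendsto (fun n : ℕ => ∫ x, ∏ i ∈ F, f i ((T i)^[n] x) ∂m) atTop
      (𝓝 (∏ i ∈ F, ∫ x, f i x ∂m)) by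
    let f' : ι → X → ℂ := fun i => if i ∈ F then f i else fun x => ((1 : PontryaginDual X) x : ℂ)
    have hf' : ∀ i ∈ F, f' i = f i := fun i hi => if_pos hi
    have := H F subset_rfl f' (fun i => ?_) (fun i x => ?_) (fun i hi => ⟨1, if_neg hi⟩)
    · rw [Finset.prod_congr rfl fun i hi => by rw [hf' i hi]] at this
      refine this.congr fun n => ?_
      congr 1
      ext x
      exact Finset.prod_congr rfl fun i hi => by rw [hf' i hi]
    · by_cases hi : i ∈ F
      · rw [hf' i hi]
        exact hfm i
      · simp only [f', if_neg hi]
        exact aestronglyMeasurable_const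
    · by_cases hi : i ∈ F
      · rw [hf' i hi]
        exact hfb i x
      · simp only [f', if_neg hi, Circle.norm_coe, le_refl]
  intro J
  induction J using Finset.induction_on with
  | empty =>
    intro _ f hfm hfb hf
    choose χ hχ using fun i => hf i (Finset.notMem_empty i)
    obtain rfl : f = fun i x => (χ i x : ℂ) := funext hχ
    by_cases h1 : ∃ i ∈ F, χ i ≠ 1
    · obtain ⟨i, hi, hne⟩ := h1
      rw [Finset.prod_eq_zero hi (integral_charC_of_ne_one hne)]
      refine tendsto_const_nhds.congr' ?_
      filter_upwards [h χ ⟨i, hi, hne⟩] with n hn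
      obtain ⟨x, hx⟩ := hn
      let ψ : PontryaginDual X := ∏ i ∈ F, PontryaginDual.map (iterHom (T i) n) (χ i)
      have hψ : ∀ x, ψ x = ∏ i ∈ F, χ i ((T i)^[n] x) := prod_map_iterHom_apply F T χ n
      have hψ1 : ψ ≠ 1 := by
        intro h
        refine hx ?_
        rw [← hψ, h]
        rfl
      rw [← integral_charC_of_ne_one hψ1]
      congr 1
      ext x
      rw [hψ]
      exact map_prod Circle.coeHom _ _
    · push Not at h1
      have h2 : ∀ i ∈ F, ∀ x, ((χ i x : Circle) : ℂ) = 1 := by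
        intro i hi x
        rw [h1 i hi]
        rfl
      have h3 : ∀ n : ℕ, ∀ x, ∏ i ∈ F, ((χ i ((T i)^[n] x) : Circle) : ℂ) = 1 := fun n x =>
        Finset.prod_eq_one fun i hi => h2 i hi _
      have h4 : ∀ i ∈ F, ∫ x, ((χ i x : Circle) : ℂ) ∂m = 1 := by
        intro i hi
        simp [h2 i hi]
      simp only [h3, Finset.prod_eq_one h4]
      simp
  | insert i J hiJ ih =>
    intro hJF f hfm hfb hf
    have hi : i ∈ F := hJF (Finset.mem_insert_self i J)
    have hR : ∀ n : ℕ, AEStronglyMeasurable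
        (fun x => ∏ j ∈ F.erase i, f j ((T j)^[n] x)) m := fun n =>
      Finset.aestronglyMeasurable_fun_prod _ fun j hj =>
        (hfm j).comp_measurePreserving (measurePreserving_iterate (hT j (Finset.mem_of_mem_erase hj)) n)
    have := tendsto_integral_mul_of_characters (fun n => (T i)^[n])
      (fun n => measurePreserving_iterate (hT i hi) n)
      (fun n x => ∏ j ∈ F.erase i, f j ((T j)^[n] x)) hR 1
      (fun n x => by
        rw [norm_prod]
        exact Finset.prod_le_one (fun _ _ => norm_nonneg _) fun j _ => hfb j _)
      (∏ j ∈ F.erase i, ∫ x, f j x ∂m) (fun χ => ?_) (f i)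
      (Integrable.of_bound (hfm i) 1 (Eventually.of_forall (hfb i)))
    · rw [Finset.mul_prod_erase F (fun j => ∫ x, f j x ∂m) hi] at this
      refine this.congr fun n => ?_
      congr 1
      ext x
      exact Finset.mul_prod_erase F (fun j => f j ((T j)^[n] x)) hi
    · have h1 := ih ((Finset.subset_insert i J).trans hJF)
        (Function.update f i fun x => (χ x : ℂ)) (fun j => ?_) (fun j x => ?_) (fun j hj => ?_)
      · rw [← Finset.mul_prod_erase F _ hi] at h1
        simp only [← Finset.mul_prod_erase F _ hi, Function.update_self] at h1
        rw [Finset.prod_congr rfl fun j hj => by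
          rw [Function.update_of_ne (Finset.ne_of_mem_erase hj)]] at h1
        refine h1.congr fun n => ?_
        congr 1
        ext x
        congr 1
        exact Finset.prod_congr rfl fun j hj => by
          rw [Function.update_of_ne (Finset.ne_of_mem_erase hj)]
      · by_cases hji : j = i
        · subst hji
          rw [Function.update_self]
          exact (charC χ).continuous.aestronglyMeasurable
        · rw [Function.update_of_ne hji]
          exact hfm j
      · by_cases hji : j = i
        · subst hji
          rw [Function.update_self, Circle.norm_coe]
        · rw [Function.update_of_ne hji]
          exact hfb j x
      · by_cases hji : j = i
        · subst hji
          exact ⟨χ, Function.update_self _ _ _⟩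
        · rw [Function.update_of_ne hji]
          exact hf j (by simp [hji, hj])

theorem isMixingSet_of_characters [T2Space X] (F : Finset (X →ₜ* X))
    (hF : ∀ γ ∈ F, Function.Surjective γ)
    (h : ∀ χ : (X →ₜ* X) → PontryaginDual X, (∃ γ ∈ F, χ γ ≠ 1) →
      ∀ᶠ n in atTop, ∃ x, ∏ γ ∈ F, χ γ ((⇑γ)^[n] x) ≠ 1) : IsMixingSet F := by
  classical
  intro B hB
  set m := normalizedHaar X
  -- The integral statement asks for measurability at every index, so the sets outside F are
  -- replaced by a harmless default.
  let B' : (X →ₜ* X) → Set X := fun γ => if γ ∈ F then B γ else ∅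
  have hB' : ∀ γ ∈ F, B' γ = B γ := fun γ hγ => if_pos hγ
  have hB'm : ∀ γ, NullMeasurableSet (B' γ) m := by
    intro γ
    by_cases hγ : γ ∈ F
    · rw [hB' γ hγ]
      exact hB γ hγ
    · simp only [B', if_neg hγ]
      exact nullMeasurableSet_empty
  have key := tendsto_integral_prod_of_characters F (fun γ => γ) hF h
    (fun γ => (B' γ).indicator fun _ => 1)
    (fun γ => aestronglyMeasurable_const.indicator₀ (hB'm γ))
    (fun γ x => by
      by_cases hx : x ∈ B' γ
      · simp [hx]
      · simp [hx])
  have e1 : ∀ s : Set X, NullMeasurableSet s m → ∫ x, s.indicator (fun _ => (1 : ℂ)) x ∂m =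
      ((m.real s : ℝ) : ℂ) := by
    intro s hs
    rw [integral_indicator₀ hs]
    simp
  have e2 : ∀ n : ℕ, NullMeasurableSet (⋂ γ ∈ F, (⇑γ)^[n] ⁻¹' B γ) m := fun n =>
    Finset.nullMeasurableSet_biInter _ fun γ hγ =>
      (hB γ hγ).preimage (measurePreserving_iterate (hF γ hγ) n).quasiMeasurePreserving
  have e3 : ∀ n : ℕ, ∫ x, ∏ γ ∈ F, (B' γ).indicator (fun _ => (1 : ℂ)) ((⇑γ)^[n] x) ∂m =
      ((m.real (⋂ γ ∈ F, (⇑γ)^[n] ⁻¹' B γ) : ℝ) : ℂ) := by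
    intro n
    rw [← e1 _ (e2 n)]
    congr 1
    ext x
    by_cases hx : x ∈ ⋂ γ ∈ F, (⇑γ)^[n] ⁻¹' B γ
    · rw [indicator_of_mem hx]
      refine Finset.prod_eq_one fun γ hγ => indicator_of_mem ?_ _
      rw [hB' γ hγ]
      exact mem_iInter₂.1 hx γ hγ
    · rw [indicator_of_notMem hx]
      simp only [mem_iInter, not_forall] at hx
      obtain ⟨γ, hγ, hx⟩ := hx
      refine Finset.prod_eq_zero hγ (indicator_of_notMem ?_ _)
      rw [hB' γ hγ]
      exact hx
  have e4 : ∏ γ ∈ F, ∫ x, (B' γ).indicator (fun _ => (1 : ℂ)) x ∂m =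
      (((∏ γ ∈ F, m (B γ)).toReal : ℝ) : ℂ) := by
    rw [ENNReal.toReal_prod]
    push_cast
    refine Finset.prod_congr rfl fun γ hγ => ?_
    rw [e1 _ (hB'm γ), hB' γ hγ]
    rfl
  rw [e4] at key
  replace key := key.congr e3
  have key2 := (Complex.continuous_re.tendsto _).comp key
  change Tendsto (fun n : ℕ => (m (⋂ γ ∈ F, (⇑γ)^[n] ⁻¹' B γ)).toReal) atTop _ at key2
  refine (ENNReal.tendsto_toReal_iff (fun n => measure_ne_top m _) ?_).1 key2
  exact ENNReal.prod_ne_top fun γ _ => measure_ne_top m _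

/-- Choose nonempty open sets on which the product of the χ_γ, at independent points, avoids 1. The
identity makes the intersections empty for all multiples of l, while nonempty open sets have
positive measure. -/
theorem not_isMixingSet_of_characters (F : Finset (X →ₜ* X))
    (χ : (X →ₜ* X) → PontryaginDual X) (hχ : ∃ γ ∈ F, χ γ ≠ 1) (l : ℕ) (hl : 1 ≤ l)
    (h : ∀ n x, ∏ γ ∈ F, χ γ ((⇑γ)^[l * n] x) = 1) : ¬ IsMixingSet F := by
  classical
  intro hmix
  obtain ⟨γ₀, hγ₀, hne⟩ := hχ
  obtain ⟨a, ha⟩ : ∃ a, χ γ₀ a ≠ 1 := by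
    by_contra! h
    exact hne (PontryaginDual.ext h)
  let w : (X →ₜ* X) → X := Function.update (fun _ => 1) γ₀ a
  have hcont : Continuous fun z : (X →ₜ* X) → Circle => ∏ γ ∈ F, z γ := by fun_prop
  have hw : ∏ γ ∈ F, χ γ (w γ) ≠ 1 := by
    rw [Finset.prod_eq_single_of_mem γ₀ hγ₀ fun γ _ hγ => by
      simp only [w]
      rw [Function.update_of_ne hγ, map_one]]
    simpa [w] using ha
  have hopen : IsOpen {z : (X →ₜ* X) → Circle | ∏ γ ∈ F, z γ ≠ 1} :=
    isOpen_ne.preimage hcont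
  obtain ⟨I, u, hu, hsub⟩ := isOpen_pi_iff.1 hopen (fun γ => χ γ (w γ)) hw
  let B : (X →ₜ* X) → Set X := fun γ => if γ ∈ I then χ γ ⁻¹' u γ else univ
  have hBo : ∀ γ, IsOpen (B γ) := by
    intro γ
    by_cases hγ : γ ∈ I
    · simp only [B, if_pos hγ]
      exact (hu γ hγ).1.preimage (map_continuous _)
    · simp only [B, if_neg hγ, isOpen_univ]
  have hBne : ∀ γ, (B γ).Nonempty := by
    intro γ
    by_cases hγ : γ ∈ I
    · simp only [B, if_pos hγ]
      exact ⟨w γ, (hu γ hγ).2⟩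
    · simp only [B, if_neg hγ, univ_nonempty]
  have hlim := (hmix B fun γ _ => (hBo γ).nullMeasurableSet).comp
    (tendsto_id.const_mul_atTop' (by omega : 0 < l))
  change Tendsto (fun n => normalizedHaar X (⋂ γ ∈ F, (⇑γ)^[l * n] ⁻¹' B γ)) atTop _ at hlim
  have hempty : ∀ n, ⋂ γ ∈ F, (⇑γ)^[l * n] ⁻¹' B γ = ∅ := by
    intro n
    refine eq_empty_iff_forall_notMem.2 fun x hx => ?_
    let z : (X →ₜ* X) → Circle := fun γ => if γ ∈ F then χ γ ((⇑γ)^[l * n] x) else χ γ (w γ)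
    have hz : z ∈ (I : Set (X →ₜ* X)).pi u := by
      intro γ hγ
      by_cases hγF : γ ∈ F
      · have h1 := mem_iInter₂.1 hx γ hγF
        simp only [B, mem_preimage] at h1
        rw [if_pos (by exact hγ)] at h1
        simp only [z, if_pos hγF]
        exact h1
      · simp only [z, if_neg hγF]
        exact (hu γ hγ).2
    have h1 := hsub hz
    refine h1 ?_
    rw [← h n x]
    exact Finset.prod_congr rfl fun γ hγ => if_pos hγ
  simp only [hempty, measure_empty] at hlim
  have h0 := tendsto_nhds_unique hlim tendsto_const_nhds
  obtain ⟨γ, -, hγ⟩ := Finset.prod_eq_zero_iff.1 h0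
  exact ((hBo γ).measure_pos _ (hBne γ)).ne' hγ

end Mixing

/-! ### Lebesgue's covering theorem for the cube -/

section Cube

/-- A small perturbation `t ↦ t + σ u t` of the identity which preserves the faces of the unit
cube maps the open cube bijectively onto itself. -/
theorem image_openCube_eq {r : ℕ} (u : (Fin r → ℝ) → Fin r → ℝ) (hu : ContDiff ℝ 1 u) (K : NNReal)
    (hK : LipschitzOnWith K u (Icc 0 1))
    (h0 : ∀ t ∈ Icc (0 : Fin r → ℝ) 1, ∀ j, t j = 0 → u t j = 0)
    (h1 : ∀ t ∈ Icc (0 : Fin r → ℝ) 1, ∀ j, t j = 1 → u t j = 0)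
    (σ : ℝ) (hσ : 0 ≤ σ) (hσK : σ * K ≤ 1 / 2)
    (hdet : ∀ t ∈ univ.pi fun _ : Fin r => Ioo (0 : ℝ) 1,
      (ContinuousLinearMap.id ℝ (Fin r → ℝ) + σ • fderiv ℝ u t).det ≠ 0) :
    InjOn (fun t => t + σ • u t) (univ.pi fun _ : Fin r => Ioo (0 : ℝ) 1) ∧
      (fun t => t + σ • u t) '' (univ.pi fun _ : Fin r => Ioo (0 : ℝ) 1) =
        univ.pi fun _ : Fin r => Ioo (0 : ℝ) 1 := by
  set Q : Set (Fin r → ℝ) := univ.pi fun _ : Fin r => Ioo (0 : ℝ) 1 with hQ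
  set f : (Fin r → ℝ) → Fin r → ℝ := fun t => t + σ • u t with hf
  have hQI : Q ⊆ Icc 0 1 := fun t ht =>
    ⟨fun j => (ht j trivial).1.le, fun j => (ht j trivial).2.le⟩
  have hinj : InjOn f (Icc 0 1) := by
    intro x hx y hy hxy
    have e1 : x - y = σ • (u y - u x) := by
      have : x + σ • u x = y + σ • u y := hxy
      rw [smul_sub, sub_eq_sub_iff_add_eq_add, this, add_comm]
    have e2 : ‖x - y‖ ≤ σ * (K * ‖x - y‖) := by
      conv_lhs => rw [e1]
      rw [norm_smul, Real.norm_of_nonneg hσ, norm_sub_rev]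
      gcongr
      have := hK.dist_le_mul x hx y hy
      rwa [dist_eq_norm, dist_eq_norm] at this
    have e3 : ‖x - y‖ ≤ 1 / 2 * ‖x - y‖ := by
      rw [← mul_assoc] at e2
      exact e2.trans (mul_le_mul_of_nonneg_right hσK (norm_nonneg _))
    have e4 : ‖x - y‖ = 0 := by
      have := norm_nonneg (x - y)
      linarith
    exact sub_eq_zero.1 (norm_eq_zero.1 e4)
  -- Comparing t with its projection to the face t_j = b, where u_j vanishes, shows that the
  -- perturbation covers at most half the distance to that face.
  have hcoord : ∀ t ∈ Icc (0 : Fin r → ℝ) 1, ∀ j, ∀ b : ℝ, b ∈ Icc (0 : ℝ) 1 →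
      (∀ t ∈ Icc (0 : Fin r → ℝ) 1, t j = b → u t j = 0) → |σ * u t j| ≤ 1 / 2 * |t j - b| := by
    intro t ht j b hb hz
    have hmem : Function.update t j b ∈ Icc (0 : Fin r → ℝ) 1 := by
      refine ⟨fun k => ?_, fun k => ?_⟩
      · by_cases hk : k = j
        · subst hk
          simpa using hb.1
        · simpa [hk] using ht.1 k
      · by_cases hk : k = j
        · subst hk
          simpa using hb.2
        · simpa [hk] using ht.2 k
    have e1 := hK.dist_le_mul t ht _ hmem
    have e2 : dist t (Function.update t j b) ≤ |t j - b| := by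
      refine (dist_pi_le_iff (abs_nonneg _)).2 fun k => ?_
      by_cases hk : k = j
      · subst hk
        simp [Real.dist_eq]
      · simp [hk]
    have e3 : |u t j| ≤ dist (u t) (u (Function.update t j b)) := by
      have := dist_le_pi_dist (u t) (u (Function.update t j b)) j
      rwa [hz _ hmem (by simp), Real.dist_eq, sub_zero] at this
    rw [abs_mul, abs_of_nonneg hσ]
    calc σ * |u t j| ≤ σ * (K * |t j - b|) := by
          gcongr
          exact e3.trans (e1.trans (by gcongr))
      _ = σ * K * |t j - b| := by ring
      _ ≤ 1 / 2 * |t j - b| := by gcongr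
  have hmaps : f '' Q ⊆ Q := by
    rintro - ⟨t, ht, rfl⟩ j -
    have ht' := hQI ht
    have e1 := hcoord t ht' j 0 (by simp) fun t ht => h0 t ht j
    have e2 := hcoord t ht' j 1 (by simp) fun t ht => h1 t ht j
    obtain ⟨e3, e4⟩ := ht j trivial
    rw [sub_zero, abs_of_pos e3] at e1
    rw [abs_of_neg (show t j - 1 < 0 by linarith)] at e2
    have e5 := abs_le.1 e1
    have e6 := abs_le.1 e2
    change t j + σ * u t j ∈ Ioo (0 : ℝ) 1
    constructor <;> linarith
  have hcont : Continuous f := continuous_id.add (hu.continuous.const_smul σ)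
  have hopen : IsOpen (f '' Q) := by
    refine isOpen_iff_mem_nhds.2 ?_
    rintro - ⟨t, ht, rfl⟩
    have hs : HasStrictFDerivAt f (ContinuousLinearMap.id ℝ (Fin r → ℝ) + σ • fderiv ℝ u t) t :=
      (hasStrictFDerivAt_id t).add
        ((hu.contDiffAt.hasStrictFDerivAt one_ne_zero).const_smul σ)
    rw [← ContinuousLinearMap.coe_toContinuousLinearEquivOfDetNeZero _ (hdet t ht)] at hs
    rw [← hs.map_nhds_eq_of_equiv]
    exact image_mem_map ((isOpen_set_pi finite_univ fun _ _ => isOpen_Ioo).mem_nhds ht)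
  refine ⟨hinj.mono hQI, hmaps.antisymm ?_⟩
  -- The image is open, and relatively closed in the connected set Q: a limit point is the image of
  -- a point of the closed cube, and boundary points stay on their faces, outside Q.
  have hconv : Convex ℝ Q := convex_pi fun _ _ => convex_Ioo 0 1
  refine hconv.isPreconnected.subset_of_closure_inter_subset hopen ?_ ?_
  · have : (fun _ => 1 / 2 : Fin r → ℝ) ∈ Q := fun j _ => by norm_num
    exact ⟨_, hmaps ⟨_, this, rfl⟩, ⟨_, this, rfl⟩⟩
  · rintro y ⟨hy, hyQ⟩
    have hcl : closure (f '' Q) ⊆ f '' Icc 0 1 :=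
      closure_minimal (image_mono hQI) (isCompact_Icc.image hcont).isClosed
    obtain ⟨x, hx, rfl⟩ := hcl hy
    refine ⟨x, fun j _ => ?_, rfl⟩
    have e1 := hyQ j trivial
    change x j + σ * u x j ∈ Ioo (0 : ℝ) 1 at e1
    refine ⟨lt_of_le_of_ne (hx.1 j) fun h => ?_, lt_of_le_of_ne (hx.2 j) fun h => ?_⟩
    · rw [h0 x hx j h.symm, ← h] at e1
      simp at e1
    · rw [h1 x hx j h, h] at e1
      simp at e1

-- The degree bound is what lets values at r + 1 small σ determine the value at σ = 1.
open Polynomial in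
theorem exists_polynomial_det {r : ℕ} (A : (Fin r → ℝ) →L[ℝ] Fin r → ℝ) :
    ∃ p : ℝ[X], p.natDegree ≤ r ∧
      ∀ σ : ℝ, p.eval σ = (ContinuousLinearMap.id ℝ (Fin r → ℝ) + σ • A).det := by
  let M := LinearMap.toMatrix' (A : (Fin r → ℝ) →ₗ[ℝ] Fin r → ℝ)
  refine ⟨Matrix.det ((X : ℝ[X]) • M.map C + (1 : Matrix (Fin r) (Fin r) ℝ).map C), ?_, fun σ => ?_⟩
  · simpa using natDegree_det_X_add_C_le M 1
  · rw [ContinuousLinearMap.det, ← LinearMap.det_toMatrix', ← coe_evalRingHom, RingHom.map_det]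
    congr 1
    ext i j
    simp only [coe_evalRingHom, RingHom.mapMatrix_apply, Matrix.map_apply, Matrix.add_apply,
      Matrix.smul_apply, smul_eq_mul, eval_add, eval_mul, eval_X, eval_C, M,
      LinearMap.toMatrix'_apply, Matrix.one_apply]
    simp [Pi.single_apply, add_comm]

/-- A `C¹` map of the unit cube which preserves its faces has a regular point. -/
theorem exists_det_fderiv_ne_zero {r : ℕ} (g : (Fin r → ℝ) → Fin r → ℝ) (hg : ContDiff ℝ 1 g)
    (h0 : ∀ t ∈ Icc (0 : Fin r → ℝ) 1, ∀ j, t j = 0 → g t j = 0)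
    (h1 : ∀ t ∈ Icc (0 : Fin r → ℝ) 1, ∀ j, t j = 1 → g t j = 1) :
    ∃ t, (fderiv ℝ g t).det ≠ 0 := by
  -- The integral over Q of det(1 + σ Du) is a polynomial in σ. For small σ it is the volume of the
  -- image of Q under t + σu(t), namely 1, so it is 1 at σ = 1 too, where the integrand det Dg is
  -- assumed to vanish.
  by_contra! hcon
  set Q : Set (Fin r → ℝ) := univ.pi fun _ : Fin r => Ioo (0 : ℝ) 1 with hQ
  have hQI : Q ⊆ Icc 0 1 := fun t ht =>
    ⟨fun j => (ht j trivial).1.le, fun j => (ht j trivial).2.le⟩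
  have hQm : MeasurableSet Q := MeasurableSet.univ_pi fun _ => measurableSet_Ioo
  have hQv : volume Q = 1 := by
    rw [hQ, Real.volume_pi_Ioo]
    simp
  set u : (Fin r → ℝ) → Fin r → ℝ := fun t => g t - t with hu
  have huc : ContDiff ℝ 1 u := hg.sub contDiff_id
  have hug : ∀ t, fderiv ℝ g t = ContinuousLinearMap.id ℝ (Fin r → ℝ) + (1 : ℝ) • fderiv ℝ u t := by
    intro t
    have h2 : fderiv ℝ u t = fderiv ℝ g t - fderiv ℝ id t :=
      fderiv_sub (hg.differentiable one_ne_zero t) differentiableAt_id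
    rw [h2, fderiv_id, one_smul, add_sub_cancel]
  have hfc : Continuous (fderiv ℝ u) := huc.continuous_fderiv one_ne_zero
  obtain ⟨K, hK⟩ : ∃ K : NNReal, ∀ t ∈ Icc (0 : Fin r → ℝ) 1, ‖fderiv ℝ u t‖₊ ≤ K := by
    obtain ⟨C, hC⟩ := (isCompact_Icc (a := (0 : Fin r → ℝ)) (b := 1)).exists_bound_of_continuousOn
      hfc.continuousOn
    exact ⟨⟨max C 0, le_max_right _ _⟩, fun t ht => (hC t ht).trans (le_max_left _ _)⟩
  have hLip : LipschitzOnWith K u (Icc 0 1) :=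
    (convex_Icc 0 1).lipschitzOnWith_of_nnnorm_fderiv_le
      (fun t _ => huc.differentiable one_ne_zero t) hK
  obtain ⟨δ, hδ, hdet⟩ : ∃ δ > 0, ∀ A : (Fin r → ℝ) →L[ℝ] Fin r → ℝ, ‖A‖ < δ →
      0 < (ContinuousLinearMap.id ℝ (Fin r → ℝ) + A).det := by
    have hc : Continuous fun A : (Fin r → ℝ) →L[ℝ] Fin r → ℝ =>
        (ContinuousLinearMap.id ℝ (Fin r → ℝ) + A).det :=
      ContinuousLinearMap.continuous_det.comp (continuous_const.add continuous_id)
    have h2 : {A : (Fin r → ℝ) →L[ℝ] Fin r → ℝ |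
        0 < (ContinuousLinearMap.id ℝ (Fin r → ℝ) + A).det} ∈ 𝓝 0 := by
      refine hc.continuousAt.eventually (lt_mem_nhds ?_)
      simp [ContinuousLinearMap.det]
    obtain ⟨δ, hδ, hsub⟩ := Metric.mem_nhds_iff.1 h2
    exact ⟨δ, hδ, fun A hA => hsub (by simpa using hA)⟩
  set ε : ℝ := min (δ / (2 * (K + 1))) (1 / (2 * (K + 1))) with hε
  have hε0 : 0 < ε := by positivity
  have hsmall : ∀ σ : ℝ, 0 ≤ σ → σ ≤ ε → σ * K ≤ 1 / 2 ∧ σ * K < δ := by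
    intro σ hσ hσε
    have hK0 : (0 : ℝ) ≤ K := K.2
    have e1 : σ * (2 * (K + 1)) ≤ δ :=
      (le_div_iff₀ (by positivity)).1 (hσε.trans (min_le_left _ _))
    have e2 : σ * (2 * (K + 1)) ≤ 1 :=
      (le_div_iff₀ (by positivity)).1 (hσε.trans (min_le_right _ _))
    have e3 : 0 ≤ σ * K := by positivity
    constructor <;> nlinarith
  have hposdet : ∀ σ : ℝ, 0 ≤ σ → σ ≤ ε → ∀ t ∈ Q,
      0 < (ContinuousLinearMap.id ℝ (Fin r → ℝ) + σ • fderiv ℝ u t).det := by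
    intro σ hσ hσε t ht
    refine hdet _ (lt_of_le_of_lt ?_ (hsmall σ hσ hσε).2)
    rw [norm_smul, Real.norm_of_nonneg hσ]
    gcongr
    exact hK t (hQI ht)
  have hintegral : ∀ σ : ℝ, 0 ≤ σ → σ ≤ ε →
      ∫ t in Q, (ContinuousLinearMap.id ℝ (Fin r → ℝ) + σ • fderiv ℝ u t).det = 1 := by
    intro σ hσ hσε
    obtain ⟨hinj, himg⟩ := image_openCube_eq u huc K hLip
      (fun t ht j htj => by simp [u, h0 t ht j htj, htj])
      (fun t ht j htj => by simp [u, h1 t ht j htj, htj]) σ hσ (hsmall σ hσ hσε).1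
      (fun t ht => (hposdet σ hσ hσε t ht).ne')
    have hder : ∀ t ∈ Q, HasFDerivWithinAt (fun t => t + σ • u t)
        (ContinuousLinearMap.id ℝ (Fin r → ℝ) + σ • fderiv ℝ u t) Q t := fun t _ =>
      ((hasFDerivAt_id t).add
        ((huc.differentiable one_ne_zero t).hasFDerivAt.const_smul σ)).hasFDerivWithinAt
    have e1 := integral_image_eq_integral_abs_det_fderiv_smul volume hQm hder hinj fun _ => (1 : ℝ)
    rw [himg, ← hQ] at e1
    simp only [smul_eq_mul, mul_one, integral_const, measureReal_def, Measure.restrict_apply_univ,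
      hQv, ENNReal.toReal_one] at e1
    rw [e1]
    exact setIntegral_congr_fun hQm fun t ht => (abs_of_pos (hposdet σ hσ hσε t ht)).symm
  have hint : ∀ σ : ℝ, IntegrableOn
      (fun t => (ContinuousLinearMap.id ℝ (Fin r → ℝ) + σ • fderiv ℝ u t).det) Q := by
    intro σ
    refine IntegrableOn.mono_set (ContinuousOn.integrableOn_compact isCompact_Icc
      (Continuous.continuousOn ?_)) hQI
    exact ContinuousLinearMap.continuous_det.comp (continuous_const.add (hfc.const_smul σ))
  -- The nodes v 0, …, v r are distinct and at most ε. Lagrange interpolation at them is applied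
  -- pointwise under the integral, extrapolating to σ = 1.
  let v : ℕ → ℝ := fun k => ε / (k + 1)
  have hvinj : Function.Injective v := by
    intro a b hab
    have ha : (0 : ℝ) < a + 1 := by positivity
    have hb : (0 : ℝ) < b + 1 := by positivity
    have : ε * (b + 1) = ε * (a + 1) := (div_eq_div_iff ha.ne' hb.ne').1 hab
    have := mul_left_cancel₀ hε0.ne' this
    exact_mod_cast (add_right_cancel this).symm
  have hv0 : ∀ k, 0 ≤ v k := fun k => by positivity
  have hvε : ∀ k, v k ≤ ε := fun k => div_le_self hε0.le (by simp)
  let L : ℕ → ℝ := fun k => (Lagrange.basis (Finset.range (r + 1)) v k).eval 1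
  have hLsum : ∑ k ∈ Finset.range (r + 1), L k = 1 := by
    have := congrArg (Polynomial.eval 1)
      (Lagrange.sum_basis (s := Finset.range (r + 1)) hvinj.injOn ⟨0, by simp⟩)
    rwa [Polynomial.eval_finsetSum, Polynomial.eval_one] at this
  have hinterp : ∀ t, ∑ k ∈ Finset.range (r + 1),
      (ContinuousLinearMap.id ℝ (Fin r → ℝ) + v k • fderiv ℝ u t).det * L k = 0 := by
    intro t
    obtain ⟨p, hpdeg, hp⟩ := exists_polynomial_det (fderiv ℝ u t)
    have hpd : p.degree < (Finset.range (r + 1)).card := by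
      rw [Finset.card_range]
      exact (Polynomial.degree_le_of_natDegree_le hpdeg).trans_lt (by exact_mod_cast Nat.lt_succ_self r)
    have e1 := congrArg (Polynomial.eval 1) (Lagrange.eq_interpolate hvinj.injOn hpd)
    rw [hp, ← hug, hcon, Lagrange.interpolate_apply, Polynomial.eval_finsetSum] at e1
    rw [e1]
    refine Finset.sum_congr rfl fun k _ => ?_
    rw [Polynomial.eval_mul, Polynomial.eval_C, hp]
  have e1 : ∫ t in Q, ∑ k ∈ Finset.range (r + 1),
      (ContinuousLinearMap.id ℝ (Fin r → ℝ) + v k • fderiv ℝ u t).det * L k = 1 := by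
    rw [integral_finsetSum _ fun k _ => (hint (v k)).mul_const (L k)]
    rw [← hLsum]
    refine Finset.sum_congr rfl fun k _ => ?_
    rw [integral_mul_const, hintegral _ (hv0 k) (hvε k), one_mul]
  simp only [hinterp, integral_zero] at e1
  exact zero_ne_one e1

open scoped Manifold ContDiff in
/-- Lebesgue's covering theorem: a finite open cover none of whose members meets two opposite faces
of the unit cube has a point lying in more members than the dimension. -/
theorem exists_lt_card_of_cover {r : ℕ} {ι : Type*} [Fintype ι] (V : ι → Set (Fin r → ℝ))
    (hV : ∀ i, IsOpen (V i)) (hcov : ⋃ i, V i = univ) (side : ι → Fin r → Prop)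
    (h0 : ∀ i j, side i j → ∀ t ∈ V i, t j ≠ 0) (h1 : ∀ i j, ¬ side i j → ∀ t ∈ V i, t j ≠ 1) :
    ∃ t, r < {i | t ∈ V i}.ncard := by
  classical
  obtain ⟨φ, hφ⟩ := SmoothPartitionOfUnity.exists_isSubordinate 𝓘(ℝ, Fin r → ℝ)
    (isClosed_univ (X := Fin r → ℝ)) V hV hcov.ge
  have hφc : ∀ i, ContDiff ℝ ∞ (φ i) := fun i => (φ i).contMDiff.contDiff
  have hφs : ∀ t, ∑ i, φ i t = 1 := by
    intro t
    rw [← finsum_eq_sum_of_fintype]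
    exact φ.sum_eq_one (mem_univ t)
  have hφ0 : ∀ i t, t ∉ V i → φ i t = 0 := fun i t ht => by
    by_contra h
    exact ht (hφ i (subset_tsupport _ h))
  -- Each member of the cover is sent to a vertex of the cube, with coordinate 1 when it misses the
  -- face t_j = 0 and 0 when it misses t_j = 1. The map g averaging these vertices therefore
  -- preserves faces.
  let p : ι → Fin r → ℝ := fun i j => if side i j then 1 else 0
  let g : (Fin r → ℝ) → Fin r → ℝ := fun t => ∑ i, φ i t • p i
  have hgc : ContDiff ℝ 1 g :=
    ContDiff.sum fun i _ => ((hφc i).of_le (by exact_mod_cast le_top)).smul contDiff_const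
  have hgj : ∀ t j, g t j = ∑ i, φ i t * p i j := fun t j => by
    simp [g, Finset.sum_apply]
  obtain ⟨t, ht⟩ := exists_det_fderiv_ne_zero g hgc
    (fun t _ j htj => by
      rw [hgj]
      refine Finset.sum_eq_zero fun i _ => ?_
      by_cases hi : side i j
      · rw [hφ0 i t fun h => h0 i j hi t h htj, zero_mul]
      · simp [p, hi])
    (fun t _ j htj => by
      rw [hgj, ← hφs t]
      refine Finset.sum_congr rfl fun i _ => ?_
      by_cases hi : side i j
      · simp [p, hi]
      · rw [hφ0 i t fun h => h1 i j hi t h htj, zero_mul])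
  refine ⟨t, ?_⟩
  by_contra! hle
  let Z : Finset ι := Finset.univ.filter fun i => t ∈ V i
  have hZ : Z.card ≤ r := by
    rw [← Set.ncard_coe_finset]
    simpa [Z] using hle
  obtain ⟨i₀, hi₀⟩ : ∃ i, t ∈ V i := mem_iUnion.1 (hcov ▸ mem_univ t)
  have hi₀Z : i₀ ∈ Z := by simpa [Z] using hi₀
  have hD : ∀ i, DifferentiableAt ℝ (φ i) t := fun i => (hφc i).differentiable (by simp) t
  have hD0 : ∀ i ∉ Z, fderiv ℝ (φ i) t = 0 := by
    intro i hi
    have : t ∉ tsupport (φ i) := fun h => hi (by simpa [Z] using hφ i h)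
    exact fderiv_of_notMem_tsupport ℝ this
  have hDsum : ∑ i, fderiv ℝ (φ i) t = 0 := by
    rw [← fderiv_fun_sum fun i _ => hD i]
    simp [hφs]
  -- The derivatives of the partition functions sum to zero, so one vertex can be subtracted: the
  -- rank of Dg at t is at most |Z| - 1, and it is r at a regular point.
  have hDg : ∀ w, fderiv ℝ g t w = ∑ i ∈ Z.erase i₀, fderiv ℝ (φ i) t w • (p i - p i₀) := by
    intro w
    have e1 : fderiv ℝ g t w = ∑ i, fderiv ℝ (φ i) t w • p i := by
      simp only [g]
      rw [fderiv_fun_sum fun i _ => (hD i).smul_const (p i), sum_apply]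
      refine Finset.sum_congr rfl fun i _ => ?_
      rw [fderiv_smul_const (hD i)]
      rfl
    have e2 : ∑ i, fderiv ℝ (φ i) t w • p i₀ = 0 := by
      rw [← Finset.sum_smul, ← sum_apply, hDsum]
      simp
    rw [e1, ← sub_zero (∑ i, fderiv ℝ (φ i) t w • p i), ← e2, ← Finset.sum_sub_distrib]
    symm
    refine Finset.sum_subset_zero_on_sdiff (Finset.subset_univ _) (fun i hi => ?_)
      fun i _ => smul_sub _ _ _
    by_cases hii : i = i₀
    · simp [hii]
    · rw [hD0 i (by simpa [hii] using hi)]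
      simp
  have hsurj : Function.Surjective (fderiv ℝ g t) :=
    ((fderiv ℝ g t).toContinuousLinearEquivOfDetNeZero ht).surjective
  have htop : (⊤ : Submodule ℝ (Fin r → ℝ)) ≤
      Submodule.span ℝ ((Z.erase i₀).image fun i => p i - p i₀ : Finset (Fin r → ℝ)) := by
    intro y _
    obtain ⟨w, rfl⟩ := hsurj y
    rw [hDg]
    refine Submodule.sum_mem _ fun i hi => Submodule.smul_mem _ _ (Submodule.subset_span ?_)
    exact Finset.mem_coe.2 (Finset.mem_image_of_mem _ hi)
  have h2 := finrank_span_finset_le_card (R := ℝ) ((Z.erase i₀).image fun i => p i - p i₀)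
  rw [Set.finrank, top_le_iff.1 htop, finrank_top, Module.finrank_fin_fun] at h2
  have h3 := h2.trans Finset.card_image_le
  rw [Finset.card_erase_of_mem hi₀Z] at h3
  have h4 : 0 < Z.card := Finset.card_pos.2 ⟨i₀, hi₀Z⟩
  omega

end Cube

/-! ### Covering dimension bounds the number of independent characters -/

section Dimension

theorem exists_coveringDimLE_of_coveringDim_eq {X : Type*} [TopologicalSpace X] {d : ℕ}
    (hd : coveringDim X = d) : ∃ n ≤ d, CoveringDimLE X n := by
  by_contra! h
  have : ((d + 1 : ℕ) : ℕ∞) ≤ coveringDim X := by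
    refine le_iInf₂ fun n hn => ?_
    have := lt_of_not_ge fun hnd => h n hnd hn
    exact_mod_cast this
  rw [hd] at this
  have : d + 1 ≤ d := by exact_mod_cast this
  omega

/-- A compact abelian group of covering dimension at most `n` has no more than `n` independent
characters. -/
theorem le_of_coveringDimLE {X : Type*} [CommGroup X] [TopologicalSpace X] [IsTopologicalGroup X]
    [CompactSpace X] [T2Space X] {n r : ℕ} (hX : CoveringDimLE X n) (χ : Fin r → PontryaginDual X)
    (Φ : Fin r → (Additive (PontryaginDual X) →+ ℝ))
    (hΦ : ∀ j k, Φ j (Additive.ofMul (χ k)) = if j = k then 1 else 0) : r ≤ n := by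
  classical
  borelize X
  -- By duality each θ t is evaluation at a point c(t) of X. The factor π, rather than 2π, sends
  -- opposite faces of the cube to the distinct values 1 and -1 of χ_j.
  let θ : (Fin r → ℝ) → PontryaginDual X →* Circle := fun t =>
    { toFun := fun ψ => Circle.exp (Real.pi * ∑ j, t j * Φ j (Additive.ofMul ψ))
      map_one' := by simp
      map_mul' := fun ψ ψ' => by
        simp only [ofMul_mul, map_add, mul_add, Finset.sum_add_distrib]
        exact Circle.exp_add _ _ }
  choose c hc using fun t => exists_eval_eq (θ t)
  have hind : IsInducing fun (x : X) (ψ : PontryaginDual X) => ψ x := by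
    refine (Continuous.isClosedEmbedding ?_ ?_).isInducing
    · exact continuous_pi fun ψ => map_continuous ψ
    · intro x y hxy
      by_contra hne
      obtain ⟨ψ, hψ⟩ := exists_character_ne_one (a := x * y⁻¹) (by rwa [Ne, mul_inv_eq_one])
      refine hψ ?_
      rw [map_mul, map_inv, mul_inv_eq_one]
      exact congrFun hxy ψ
  have hcc : Continuous c := by
    refine hind.continuous_iff.2 (continuous_pi fun ψ => ?_)
    simp only [Function.comp_def, hc]
    exact Circle.exp.continuous.comp (by fun_prop)
  have hχc : ∀ t j, χ j (c t) = Circle.exp (Real.pi * t j) := by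
    intro t j
    rw [hc]
    change Circle.exp _ = _
    simp [hΦ]
  have hpi : Circle.exp Real.pi ≠ 1 := by
    intro h
    have := congrArg (fun z : Circle => (z : ℂ).re) h
    rw [Circle.coe_exp, Complex.exp_pi_mul_I] at this
    norm_num at this
  -- The pullback of U e along c misses, for each j, the face t_j = 0 or the face t_j = 1, and so do
  -- the pullbacks of a refinement.
  let U : Set (Fin r) → Set X := fun e =>
    ⋂ j, {x | (j ∈ e → χ j x ≠ 1) ∧ (j ∉ e → χ j x ≠ Circle.exp Real.pi)}
  obtain ⟨𝒱, hfin, hopen, hcov, href, hord⟩ := hX (range U) (finite_range U) (by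
    rintro - ⟨e, rfl⟩
    refine isOpen_iInter_of_finite fun j => ?_
    by_cases hj : j ∈ e
    · simp only [hj, forall_const, not_true_eq_false, false_imp_iff, and_true]
      exact isOpen_ne.preimage (map_continuous (χ j))
    · simp only [hj, false_imp_iff, not_false_eq_true, forall_const, true_and]
      exact isOpen_ne.preimage (map_continuous (χ j))) (by
    refine eq_univ_of_forall fun x => ⟨U {j | χ j x ≠ 1}, mem_range_self _, ?_⟩
    refine mem_iInter.2 fun j => ⟨fun h => h, fun h => ?_⟩
    have h1 : χ j x = 1 := by simpa using h
    rw [h1]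
    exact hpi.symm)
  have : Fintype 𝒱 := hfin.fintype
  have hside : ∀ i : 𝒱, ∃ e, (i : Set X) ⊆ U e := fun i => by
    obtain ⟨-, ⟨e, rfl⟩, h⟩ := href i i.2
    exact ⟨e, h⟩
  choose e he using hside
  obtain ⟨t, ht⟩ := exists_lt_card_of_cover (fun i : 𝒱 => c ⁻¹' i)
    (fun i => (hopen i i.2).preimage hcc)
    (eq_univ_of_forall fun t => by
      obtain ⟨V, hV, hx⟩ := hcov.ge (mem_univ (c t))
      exact mem_iUnion.2 ⟨⟨V, hV⟩, hx⟩)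
    (fun i j => j ∈ e i)
    (fun i j hij t ht htj => by
      refine (mem_iInter.1 (he i ht) j).1 hij ?_
      rw [hχc, htj]
      simp)
    (fun i j hij t ht htj => by
      refine (mem_iInter.1 (he i ht) j).2 hij ?_
      rw [hχc, htj, mul_one])
  have h1 : ({i : 𝒱 | t ∈ c ⁻¹' (i : Set X)}.ncard : ℕ∞) ≤ n + 1 := by
    refine le_trans ?_ (hord (c t))
    refine (ncard_le_encard _).trans ?_
    rw [← Subtype.val_injective.encard_image]
    refine encard_le_encard ?_
    rintro - ⟨i, hi, rfl⟩
    exact ⟨i.2, hi⟩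
  have h2 : {i : 𝒱 | t ∈ c ⁻¹' (i : Set X)}.ncard ≤ n + 1 := by exact_mod_cast h1
  omega

end Dimension

/-! ### Recurrent zeros and common eigenvalues -/

section LinearAlgebra

variable {ι V : Type*} [Fintype ι] [AddCommGroup V] [Module ℚ V]

/-- If `∑ Aᵢⁿ vᵢ` vanishes for infinitely many `n`, then some positive powers of the `Aᵢ` have
complex eigenvectors for a common eigenvalue which sum to zero. -/
theorem exists_eigenvectors_of_infinite_zeros [FiniteDimensional ℚ V] (A : ι → Module.End ℚ V)
    (hA : ∀ i, Function.Injective (A i)) (v : ι → V) (hv : v ≠ 0)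
    (hinf : {n : ℕ | ∑ i, (A i ^ n) (v i) = 0}.Infinite) :
    ∃ l : ℕ, 1 ≤ l ∧ ∃ z : ℂ, ∃ w : ι → ℂ ⊗[ℚ] V, w ≠ 0 ∧
      (∀ i, ((A i ^ l).baseChange ℂ) (w i) = z • w i) ∧ ∑ i, w i = 0 := by
  classical
  let B : Module.End ℚ (ι → V) := LinearMap.pi fun i => A i ∘ₗ LinearMap.proj i
  have hBn : ∀ n v i, (B ^ n) v i = (A i ^ n) (v i) := by
    intro n
    induction n with
    | zero => intro v i; simp
    | succ n ih =>
      intro v i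
      rw [pow_succ, pow_succ, Module.End.mul_apply, Module.End.mul_apply, ih]
      rfl
  have hB : Function.Injective B := fun x y hxy => funext fun i => hA i (congrFun hxy i)
  let L : (ι → V) →ₗ[ℚ] V := ∑ i, LinearMap.proj i
  have hL : ∀ v, L v = ∑ i, v i := fun v => by simp [L]
  obtain ⟨a, N, hN, hz⟩ := exists_arithProgression_of_infinite_zeros B hB L v (by
    simpa only [hL, hBn] using hinf)
  refine ⟨N, hN, ?_⟩
  let C : Module.End ℂ (ι → ℂ ⊗[ℚ] V) :=
    LinearMap.pi fun i => ((A i ^ N).baseChange ℂ) ∘ₗ LinearMap.proj i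
  let LC : (ι → ℂ ⊗[ℚ] V) →ₗ[ℂ] ℂ ⊗[ℚ] V := ∑ i, LinearMap.proj i
  have hLC : ∀ v, LC v = ∑ i, v i := fun v => by simp [LC]
  -- This is the largest C-invariant subspace of the kernel of the sum map. It contains the nonzero
  -- starting vector of the progression, so C has an eigenvector in it.
  let K : Submodule ℂ (ι → ℂ ⊗[ℚ] V) := ⨅ m : ℕ, LinearMap.ker (LC ∘ₗ C ^ m)
  have hK : ∀ w, w ∈ K ↔ ∀ m : ℕ, LC ((C ^ m) w) = 0 := fun w => by simp [K]
  have hCK : ∀ w ∈ K, C w ∈ K := by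
    intro w hw
    rw [hK] at hw ⊢
    intro m
    rw [← Module.End.mul_apply, ← pow_succ]
    exact hw (m + 1)
  let w₀ : ι → ℂ ⊗[ℚ] V := fun i => 1 ⊗ₜ (B ^ a) v i
  have hCw : ∀ m : ℕ, (C ^ m) w₀ = fun i => 1 ⊗ₜ (B ^ (a + N * m)) v i := by
    intro m
    induction m with
    | zero => rfl
    | succ m ih =>
      rw [pow_succ', Module.End.mul_apply, ih]
      funext i
      change ((A i ^ N).baseChange ℂ) (1 ⊗ₜ (B ^ (a + N * m)) v i) = _
      rw [LinearMap.baseChange_tmul, hBn, hBn, ← Module.End.mul_apply, ← pow_add]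
      congr 3
      ring_nf
  have hw₀ : w₀ ∈ K := by
    refine (hK _).2 fun m => ?_
    rw [hLC, hCw]
    simp only
    rw [← TensorProduct.tmul_sum, ← hL, hz, TensorProduct.tmul_zero]
  have hw₀0 : w₀ ≠ 0 := by
    intro h
    refine hv ((Module.End.iterate_injective hB a) ?_)
    funext i
    change (B ^ a) v i = (B ^ a) 0 i
    rw [map_zero]
    have h1 : (1 : ℂ) ⊗ₜ[ℚ] (B ^ a) v i = 1 ⊗ₜ[ℚ] (0 : V) := by
      rw [TensorProduct.tmul_zero]
      exact congrFun h i
    exact Module.Flat.tensorProduct_mk_injective ℚ V ℂ h1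
  have : Nontrivial K := ⟨⟨⟨w₀, hw₀⟩, 0, fun h => hw₀0 (congrArg Subtype.val h)⟩⟩
  obtain ⟨z, hz⟩ := Module.End.exists_eigenvalue (C.restrict hCK)
  obtain ⟨⟨w, hwK⟩, hw⟩ := hz.exists_hasEigenvector
  refine ⟨z, w, fun h => hw.2 (Subtype.ext h), fun i => ?_, ?_⟩
  · exact congrFun (congrArg Subtype.val hw.apply_eq_smul) i
  · rw [← hLC]
    exact (hK w).1 hwK 0

/-- Complex eigenvectors of the `Aᵢˡ` for a common eigenvalue which sum to zero yield rational
vectors with `∑ Aᵢˡⁿ vᵢ = 0` for all `n`. -/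
theorem exists_zeros_of_eigenvectors (A : ι → Module.End ℚ V) (l : ℕ) (z : ℂ)
    (w : ι → ℂ ⊗[ℚ] V) (hw : w ≠ 0) (hz : ∀ i, ((A i ^ l).baseChange ℂ) (w i) = z • w i)
    (hsum : ∑ i, w i = 0) :
    ∃ v : ι → V, v ≠ 0 ∧ ∀ n : ℕ, ∑ i, (A i ^ (l * n)) (v i) = 0 := by
  classical
  -- Coordinates along a rational basis of ℂ commute with base changes of rational maps, so one
  -- nonzero coordinate of w inherits all the relations z^n ∑ w_i = 0.
  let b := Module.Free.chooseBasis ℚ ℂ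
  let e := TensorProduct.equivFinsuppOfBasisLeft (N := V) b
  have he : ∀ k (f : Module.End ℚ V) x, e (f.baseChange ℂ x) k = f (e x k) := by
    intro k f x
    induction x with
    | zero => simp
    | add x y hx hy => simp only [map_add, Finsupp.add_apply, hx, hy]
    | tmul c y =>
      rw [LinearMap.baseChange_tmul, TensorProduct.equivFinsuppOfBasisLeft_apply_tmul_apply,
        TensorProduct.equivFinsuppOfBasisLeft_apply_tmul_apply, map_smul]
  have hzn : ∀ n i, (((A i ^ l) ^ n).baseChange ℂ) (w i) = z ^ n • w i := by
    intro n i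
    induction n with
    | zero => simp
    | succ n ih =>
      rw [pow_succ', Module.End.mul_eq_comp, LinearMap.baseChange_comp, LinearMap.comp_apply, ih,
        map_smul, hz, smul_smul, ← pow_succ]
  obtain ⟨i, hi⟩ := Function.ne_iff.1 hw
  obtain ⟨k, hk⟩ : ∃ k, e (w i) k ≠ 0 := by
    by_contra! h
    exact hi (e.injective (by ext k; simpa using h k))
  refine ⟨fun i => e (w i) k, Function.ne_iff.2 ⟨i, hk⟩, fun n => ?_⟩
  simp only [← he, pow_mul, hzn]
  rw [← Finsupp.finsetSum_apply, ← map_sum, ← Finset.smul_sum, hsum]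
  simp

end LinearAlgebra

/-! ### The rational character space and the criterion for mixing -/

section CharacterGroup

variable {X : Type*} [CommGroup X] [TopologicalSpace X]

/-- The image of χ is connected and lies in the finite set of n-th roots of unity. -/
theorem eq_one_of_pow_eq_one [ConnectedSpace X] (χ : PontryaginDual X) {n : ℕ} (hn : 0 < n)
    (h : χ ^ n = 1) : χ = 1 := by
  have hfin : (range χ).Finite := by
    refine Set.Finite.subset (s := {z : Circle | z ^ n = 1}) ?_ ?_
    · have h1 : {z : ℂ | z ^ n = 1}.Finite := by
        refine (Polynomial.nthRootsFinset n (1 : ℂ)).finite_toSet.subset fun z hz => ?_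
        exact (Polynomial.mem_nthRootsFinset hn _).2 hz
      refine (h1.preimage (f := fun z : Circle => (z : ℂ)) Subtype.val_injective.injOn).subset ?_
      intro z hz
      exact congrArg Subtype.val hz
    · rintro - ⟨x, rfl⟩
      change charEval x χ ^ n = 1
      rw [← map_pow, h, map_one]
  have hsub : (range χ).Subsingleton :=
    not_nontrivial_iff.1 fun hnt =>
      (isPreconnected_range (map_continuous χ)).infinite_of_nontrivial hnt hfin
  refine PontryaginDual.ext fun x => ?_
  exact (hsub ⟨x, rfl⟩ ⟨1, rfl⟩).trans (map_one χ)

/-- The rational vector `1 ⊗ χ`. -/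
noncomputable def ratChar (X : Type*) [CommGroup X] [TopologicalSpace X] :
    Additive (PontryaginDual X) →ₗ[ℤ] ℚ ⊗[ℤ] Additive (PontryaginDual X) :=
  TensorProduct.mk ℤ ℚ (Additive (PontryaginDual X)) 1

instance : IsLocalizedModule (nonZeroDivisors ℤ) (ratChar X) :=
  (isLocalizedModule_iff_isBaseChange (nonZeroDivisors ℤ) ℚ _).2
    (TensorProduct.isBaseChange ℤ (Additive (PontryaginDual X)) ℚ)

theorem ratChar_eq_zero_iff [ConnectedSpace X] (χ : PontryaginDual X) :
    ratChar X (Additive.ofMul χ) = 0 ↔ χ = 1 := by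
  refine ⟨fun h => ?_, fun h => by rw [h, ofMul_one, map_zero]⟩
  obtain ⟨c, hc⟩ := (IsLocalizedModule.eq_zero_iff (nonZeroDivisors ℤ) (ratChar X)).1 h
  have hc0 : (c : ℤ) ≠ 0 := nonZeroDivisors.ne_zero c.2
  have h1 : χ ^ (c : ℤ) = 1 := hc
  refine eq_one_of_pow_eq_one χ (Int.natAbs_pos.2 hc0) ?_
  rcases Int.natAbs_eq (c : ℤ) with h2 | h2
  · rwa [h2, zpow_natCast] at h1
  · rwa [h2, zpow_neg, zpow_natCast, inv_eq_one] at h1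

theorem dualRat_ratChar (T : X →ₜ* X) (χ : PontryaginDual X) :
    dualRat T (ratChar X (Additive.ofMul χ)) =
      ratChar X (Additive.ofMul (PontryaginDual.map T χ)) :=
  LinearMap.baseChange_tmul _ _ _

theorem dualRat_iterHom (T : X →ₜ* X) (n : ℕ) : dualRat (iterHom T n) = dualRat T ^ n := by
  induction n with
  | zero =>
    change (dualEnd (ContinuousMonoidHom.id X)).baseChange ℚ = 1
    have : dualEnd (ContinuousMonoidHom.id X) = LinearMap.id := rfl
    rw [this, LinearMap.baseChange_id]
    rfl
  | succ n ih =>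
    rw [pow_succ', ← ih]
    change (dualEnd ((iterHom T n).comp T)).baseChange ℚ = _
    have : dualEnd ((iterHom T n).comp T) = dualEnd T ∘ₗ dualEnd (iterHom T n) := rfl
    rw [this, LinearMap.baseChange_comp]
    rfl

/-- Precomposition with a surjection is injective, and ℚ is flat over ℤ. This supplies the
injectivity needed by the Skolem–Mahler–Lech argument. -/
theorem dualRat_injective {T : X →ₜ* X} (hT : Function.Surjective T) :
    Function.Injective (dualRat T) := by
  have h : Function.Injective (dualEnd T) := by
    intro χ ψ h
    refine PontryaginDual.ext fun x => ?_
    obtain ⟨y, rfl⟩ := hT x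
    exact DFunLike.congr_fun (F := PontryaginDual X) h y
  exact Module.Flat.lTensor_preserves_injective_linearMap (M := ℚ) _ h

theorem mem_dualSpec_iff (T : X →ₜ* X) (z : ℂ) :
    z ∈ dualSpec T ↔ ∃ u, u ≠ 0 ∧ ((dualRat T).baseChange ℂ) u = z • u := by
  constructor
  · intro h
    obtain ⟨u, hu⟩ := Module.End.HasEigenvalue.exists_hasEigenvector h
    exact ⟨u, hu.2, hu.apply_eq_smul⟩
  · rintro ⟨u, hu0, hu⟩
    exact Module.End.hasEigenvalue_of_hasEigenvector
      (Module.End.hasEigenvector_iff.2 ⟨Module.End.mem_eigenspace_iff.2 hu, hu0⟩)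

/-- The character `x ↦ ∏ χᵢ (Tᵢⁿ x)`, in the rational vector space spanned by the characters. -/
theorem sum_dualRat_ratChar_eq_zero_iff [ConnectedSpace X] {ι : Type*} (F : Finset ι)
    (T : ι → X →ₜ* X) (χ : ι → PontryaginDual X) (n : ℕ) :
    ∑ i ∈ F, (dualRat (T i) ^ n) (ratChar X (Additive.ofMul (χ i))) = 0 ↔
      ∀ x, ∏ i ∈ F, χ i ((T i)^[n] x) = 1 := by
  have h1 : ∑ i ∈ F, (dualRat (T i) ^ n) (ratChar X (Additive.ofMul (χ i))) =
      ratChar X (Additive.ofMul (∏ i ∈ F, PontryaginDual.map (iterHom (T i) n) (χ i))) := by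
    rw [ofMul_prod, map_sum]
    refine Finset.sum_congr rfl fun i _ => ?_
    rw [← dualRat_iterHom, dualRat_ratChar]
  rw [h1, ratChar_eq_zero_iff]
  simp only [← prod_map_iterHom_apply]
  exact ⟨fun h x => by rw [h]; rfl, fun h => PontryaginDual.ext h⟩

variable [IsTopologicalGroup X] [CompactSpace X] [T2Space X]

/-- Independent vectors become characters after multiplication by a common denominator N; dual
functionals divided by N are then dual to these characters. -/
theorem rank_le_of_coveringDimLE {n : ℕ} (hX : CoveringDimLE X n) :
    Module.rank ℚ (ℚ ⊗[ℤ] Additive (PontryaginDual X)) ≤ n := by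
  classical
  refine rank_le fun s hs => ?_
  let V := ℚ ⊗[ℤ] Additive (PontryaginDual X)
  obtain ⟨v, hv⟩ : ∃ v : Fin s.card → V, LinearIndependent ℚ v :=
    ⟨fun i => (s.equivFin.symm i : V), hs.comp _ s.equivFin.symm.injective⟩
  obtain ⟨N, hN⟩ := IsLocalizedModule.exist_integer_multiples_of_finite (nonZeroDivisors ℤ)
    (ratChar X) v
  choose χ hχ using hN
  have hN0 : ((N : ℤ) : ℚ) ≠ 0 := by exact_mod_cast nonZeroDivisors.ne_zero N.2
  have hf : ∀ j, ∃ f : V →ₗ[ℚ] ℚ, ∀ k, f (v k) = if j = k then 1 else 0 := by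
    intro j
    obtain ⟨f, hf⟩ := LinearMap.exists_extend ((Module.Basis.span hv).coord j)
    refine ⟨f, fun k => ?_⟩
    have h1 : v k = (Submodule.span ℚ (range v)).subtype (Module.Basis.span hv k) := by
      simp [Module.Basis.span_apply]
    rw [h1, ← LinearMap.comp_apply, hf, Module.Basis.coord_apply, Module.Basis.repr_self,
      Finsupp.single_apply]
    simp [eq_comm]
  choose f hf using hf
  refine le_of_coveringDimLE hX (fun k => (χ k).toMul)
    (fun j => (AddMonoidHom.mulLeft (((N : ℤ) : ℝ)⁻¹)).comp
      ((Rat.castHom ℝ).toAddMonoidHom.comp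
        ((f j).toAddMonoidHom.comp (ratChar X).toAddMonoidHom))) fun j k => ?_
  change ((N : ℤ) : ℝ)⁻¹ * ((f j (ratChar X (χ k)) : ℚ) : ℝ) = _
  have hNk : (N : ℤ) • v k = ((N : ℤ) : ℚ) • v k := (Int.cast_smul_eq_zsmul ℚ _ _).symm
  have h2 : ratChar X (χ k) = ((N : ℤ) : ℚ) • v k := (hχ k).trans hNk
  rw [h2, map_smul, hf]
  have hN1 : ((N : ℤ) : ℝ) ≠ 0 := by exact_mod_cast hN0
  split_ifs
  · simp [hN1]
  · simp

variable [MeasurableSpace X] [BorelSpace X]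

/-- A finite set of epimorphisms fails to be mixing exactly when positive powers of the dual maps
have complex eigenvectors for a common eigenvalue, not all zero, which sum to zero. -/
theorem not_isMixingSet_iff [ConnectedSpace X]
    [FiniteDimensional ℚ (ℚ ⊗[ℤ] Additive (PontryaginDual X))]
    {ι : Type*} (T : ι ↪ (X →ₜ* X)) (hT : ∀ i, Function.Surjective (T i)) (S : Finset ι) :
    ¬ IsMixingSet (S.map T) ↔ ∃ l : ℕ, 1 ≤ l ∧ ∃ z : ℂ,
      ∃ w : ι → ℂ ⊗[ℚ] (ℚ ⊗[ℤ] Additive (PontryaginDual X)), (∃ i ∈ S, w i ≠ 0) ∧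
        (∀ i ∈ S, ((dualRat (iterHom (T i) l)).baseChange ℂ) (w i) = z • w i) ∧
        ∑ i ∈ S, w i = 0 := by
  classical
  constructor
  · intro hmix
    obtain ⟨χ, ⟨γ, hγ, hne⟩, hfreq⟩ : ∃ χ : (X →ₜ* X) → PontryaginDual X,
        (∃ γ ∈ S.map T, χ γ ≠ 1) ∧
        ∃ᶠ n in atTop, ∀ x, ∏ γ ∈ S.map T, χ γ ((⇑γ)^[n] x) = 1 := by
      by_contra! h
      refine hmix (isMixingSet_of_characters _ (fun γ hγ => ?_) fun χ hχ => ?_)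
      · obtain ⟨i, -, rfl⟩ := Finset.mem_map.1 hγ
        exact hT i
      · exact h χ hχ
    obtain ⟨i, hi, rfl⟩ := Finset.mem_map.1 hγ
    obtain ⟨l, hl, z, w, hw, hz, hsum⟩ := exists_eigenvectors_of_infinite_zeros
      (fun i : S => dualRat (T i)) (fun i => dualRat_injective (hT i))
      (fun i : S => ratChar X (Additive.ofMul (χ (T i))))
      (Function.ne_iff.2 ⟨⟨i, hi⟩, fun h => hne ((ratChar_eq_zero_iff _).1 h)⟩)
      (by
        refine (Nat.frequently_atTop_iff_infinite.1 hfreq).mono fun n hn => ?_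
        refine (Finset.sum_coe_sort S fun i =>
          (dualRat (T i) ^ n) (ratChar X (Additive.ofMul (χ (T i))))).trans ?_
        refine (sum_dualRat_ratChar_eq_zero_iff S T (fun i => χ (T i)) n).2 fun x => ?_
        have := hn x
        rwa [Finset.prod_map] at this)
    obtain ⟨j, hj⟩ := Function.ne_iff.1 hw
    refine ⟨l, hl, z, fun i => if h : i ∈ S then w ⟨i, h⟩ else 0, ⟨j, j.2, by simpa using hj⟩,
      fun i hi => ?_, ?_⟩
    · simp only [hi, dif_pos, dualRat_iterHom]
      exact hz ⟨i, hi⟩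
    · rw [← Finset.sum_coe_sort, ← hsum]
      exact Finset.sum_congr rfl fun i _ => by simp
  · rintro ⟨l, hl, z, w, ⟨i, hi, hne⟩, hz, hsum⟩
    obtain ⟨v, hv, hv0⟩ := exists_zeros_of_eigenvectors (fun i : S => dualRat (T i)) l z
      (fun i : S => w i) (Function.ne_iff.2 ⟨⟨i, hi⟩, hne⟩)
      (fun i => by
        rw [← dualRat_iterHom]
        exact hz i i.2)
      ((Finset.sum_coe_sort S w).trans hsum)
    obtain ⟨N, hN⟩ := IsLocalizedModule.exist_integer_multiples_of_finite (nonZeroDivisors ℤ)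
      (ratChar X) v
    choose χ hχ using hN
    have hN0 : ((N : ℤ) : ℚ) ≠ 0 := by exact_mod_cast nonZeroDivisors.ne_zero N.2
    have hχ' : ∀ k, ratChar X (χ k) = ((N : ℤ) : ℚ) • v k := fun k =>
      (hχ k).trans (Int.cast_smul_eq_zsmul ℚ _ _).symm
    let χ' : ι → PontryaginDual X := fun i => if h : i ∈ S then (χ ⟨i, h⟩).toMul else 1
    obtain ⟨k, hk⟩ := Function.ne_iff.1 hv
    have : Nonempty ι := ⟨i⟩
    refine not_isMixingSet_of_characters _ (fun γ => χ' (Function.invFun T γ))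
      ⟨T k, Finset.mem_map_of_mem T k.2, fun h => ?_⟩ l hl fun n => ?_
    · rw [Function.leftInverse_invFun T.injective] at h
      have h1 : (χ k).toMul = 1 := by simpa [χ'] using h
      have h2 := (ratChar_eq_zero_iff _).2 h1
      rw [ofMul_toMul, hχ'] at h2
      exact hk ((smul_eq_zero.1 h2).resolve_left hN0)
    · have h1 := (sum_dualRat_ratChar_eq_zero_iff S T χ' (l * n)).1 (by
        rw [← Finset.sum_coe_sort]
        have h2 := congrArg (((N : ℤ) : ℚ) • ·) (hv0 n)
        simp only [smul_zero, Finset.smul_sum] at h2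
        rw [← h2]
        refine Finset.sum_congr rfl fun i _ => ?_
        rw [← map_smul, ← hχ']
        simp [χ'])
      intro x
      rw [Finset.prod_map]
      refine Eq.trans (Finset.prod_congr rfl fun i _ => ?_) (h1 x)
      rw [Function.leftInverse_invFun T.injective]

end CharacterGroup

/-! ### The three claims from the eigenvector criterion -/

theorem mainTheorem3 {X : Type*} [CommGroup X] [TopologicalSpace X] [IsTopologicalGroup X]
    [CompactSpace X] [T2Space X] [ConnectedSpace X] [MeasurableSpace X] [BorelSpace X]
    (d : ℕ) (hd : coveringDim X = d)
    (s : ℕ) (T : Fin s ↪ (X →ₜ* X)) (hT : ∀ i, Function.Surjective (T i)) :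
    ((∀ l : ℕ, 1 ≤ l → ∀ i j : Fin s, i ≠ j →
        dualSpec (iterHom (T i) l) ∩ dualSpec (iterHom (T j) l) = ∅) →
      IsMixingSet (Finset.univ.map T)) ∧
    ((∃ l : ℕ, 1 ≤ l ∧ ∃ S : Finset (Fin s), d < S.card ∧
        (⋂ i ∈ S, dualSpec (iterHom (T i) l)).Nonempty) →
      ¬ IsMixingSet (Finset.univ.map T)) ∧
    ((∀ l : ℕ, 1 ≤ l → ∀ S : Finset (Fin s), d < S.card →
        (⋂ i ∈ S, dualSpec (iterHom (T i) l)) = ∅) →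
      d ≤ s →
      (IsMixingSet (Finset.univ.map T) ↔
        ∀ E ⊆ Finset.univ.map T, E.card = d → IsMixingSet E)) := by
  classical
  obtain ⟨n, hnd, hn⟩ := exists_coveringDimLE_of_coveringDim_eq hd
  have hrank := rank_le_of_coveringDimLE hn
  have hfd : FiniteDimensional ℚ (ℚ ⊗[ℤ] Additive (PontryaginDual X)) :=
    Module.rank_lt_aleph0_iff.1 (hrank.trans_lt (Cardinal.natCast_lt_aleph0))
  have hdim : Module.finrank ℂ (ℂ ⊗[ℚ] (ℚ ⊗[ℤ] Additive (PontryaginDual X))) ≤ d := by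
    rw [Module.finrank_baseChange]
    exact (Module.finrank_le_of_rank_le hrank).trans hnd
  have key := not_isMixingSet_iff T hT
  refine ⟨fun h => ?_, ?_, fun h hds => ⟨fun hmix E hE _ => ?_, fun hE => ?_⟩⟩
  · by_contra hmix
    obtain ⟨l, hl, z, w, ⟨i, hi, hwi⟩, hz, hsum⟩ := (key _).1 hmix
    obtain ⟨j, hj, hwj⟩ : ∃ j, j ≠ i ∧ w j ≠ 0 := by
      by_contra! hcon
      rw [Finset.sum_eq_single_of_mem i hi fun j _ hji => hcon j hji] at hsum
      exact hwi hsum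
    have hmem : ∀ k, w k ≠ 0 → z ∈ dualSpec (iterHom (T k) l) := fun k hk =>
      (mem_dualSpec_iff _ _).2 ⟨w k, hk, hz k (Finset.mem_univ k)⟩
    exact eq_empty_iff_forall_notMem.1 (h l hl i j hj.symm) z ⟨hmem i hwi, hmem j hwj⟩
  · rintro ⟨l, hl, S, hS, z, hz⟩
    have hz' : ∀ i : S, ∃ u, u ≠ 0 ∧ ((dualRat (iterHom (T i) l)).baseChange ℂ) u = z • u :=
      fun i => (mem_dualSpec_iff _ _).1 (mem_iInter₂.1 hz i i.2)
    choose u hu0 hu using hz'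
    -- More than d vectors in a space of dimension at most d. Scaling the eigenvectors by the
    -- coefficients of a dependence gives the required relation, extended by zero off S.
    have hdep : ¬ LinearIndependent ℂ u := by
      intro hli
      have := hli.fintype_card_le_finrank
      rw [Fintype.card_coe] at this
      omega
    obtain ⟨c, hc, i, hi⟩ := Fintype.not_linearIndependent_iff.1 hdep
    refine (key _).2 ⟨l, hl, z, fun i => if h : i ∈ S then c ⟨i, h⟩ • u ⟨i, h⟩ else 0,
      ⟨i, Finset.mem_univ _, ?_⟩, fun j _ => ?_, ?_⟩
    · simp [hi, hu0]
    · by_cases hj : j ∈ S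
      · simp only [hj, dif_pos, map_smul]
        rw [hu ⟨j, hj⟩, smul_comm]
      · simp [hj]
    · rw [← Finset.sum_subset (Finset.subset_univ S) fun j _ hj => dif_neg hj,
        ← Finset.sum_coe_sort, ← hc]
      exact Finset.sum_congr rfl fun j _ => by simp
  · obtain ⟨S, -, rfl⟩ := Finset.subset_map_iff.1 hE
    by_contra hS
    obtain ⟨l, hl, z, w, ⟨i, hi, hwi⟩, hz, hsum⟩ := (key _).1 hS
    refine (key _).2 ⟨l, hl, z, fun i => if i ∈ S then w i else 0,
      ⟨i, Finset.mem_univ _, by simpa [hi] using hwi⟩, fun j _ => ?_, ?_⟩ hmix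
    · by_cases hj : j ∈ S
      · simpa only [hj, if_true] using hz j hj
      · simp [hj]
    · simpa using hsum
  · by_contra hmix
    obtain ⟨l, hl, z, w, ⟨i, hi, hwi⟩, hz, hsum⟩ := (key _).1 hmix
    -- All indices in the support of w share the eigenvalue z, so the hypothesis bounds its size by
    -- d; d ≤ s allows enlarging it to exactly d indices without changing the sum.
    set P : Finset (Fin s) := Finset.univ.filter fun k => w k ≠ 0 with hP
    have hPd : P.card ≤ d := by
      by_contra! hcon
      have hmem : z ∈ ⋂ k ∈ P, dualSpec (iterHom (T k) l) := by
        refine mem_iInter₂.2 fun k hk => ?_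
        exact (mem_dualSpec_iff _ _).2 ⟨w k, by simpa [hP] using hk, hz k (Finset.mem_univ k)⟩
      rw [h l hl P hcon] at hmem
      exact hmem
    obtain ⟨S, hPS, -, hSd⟩ := Finset.exists_subsuperset_card_eq (Finset.subset_univ P) hPd
      (by simpa using hds)
    refine (key S).2 ⟨l, hl, z, w, ⟨i, hPS (by simpa [hP] using hwi), hwi⟩,
      fun k _ => hz k (Finset.mem_univ k), ?_⟩
      (hE _ (Finset.map_subset_map.2 (Finset.subset_univ S)) (by rw [Finset.card_map, hSd]))
    rw [← hsum]
    refine Finset.sum_subset (Finset.subset_univ S) fun k _ hk => ?_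
    by_contra hne
    exact hk (hPS (by simpa [hP] using hne))
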